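/- Let $(S,d)$ be a geodesic metric space; balls are closed. For $\alpha\subseteq S$ and $x\in S$ let $\pi_\alpha(x)$ be the set of points of $\alpha$ closest to $x$. The set $\alpha$ is \emph{$D$-strongly contracting} if $\operatorname{diam}\bigcup_{y\in B}\pi_\alpha(y)<D$ for every ball $B$ disjoint from $\alpha$. A map $f$ from $\mathbf Z$ to a metric space $Y$ is a \emph{$q$-quasiisometric embedding} ($q\ge1$) if $\frac1q|m-n|-q\le d_Y(f(m),f(n))\le q|m-n|+q$ for all $m,n$. \emph{Curtains.} Let $D\ge1$, let $\alpha:[0,20D]\to S$ be a $D$-strongly contracting geodesic and let $I=[a,a+10D]$ with $0<a<10D$. The corresponding \emph{curtain} is $\mathfrak h=\{x:\pi_\alpha(x)\subseteq\alpha(I)\}$, with halfspaces $\mathfrak h^-=\{x:\pi_\alpha(x)\cap\alpha([0,a))\ne\varnothing\}$ and $\mathfrak h^+=\{x:\pi_\alpha(x)\cap\alpha((a+10D,20D])\ne\varnothing\}$; reversing $\alpha$ exchanges $\mathfrak h^\pm$. For $R\in\mathbf N$, disjoint curtains $\mathfrak h,\mathfrak k$ are \emph{$R$-ball-separated} if there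 is a ball $B\subseteq\mathfrak h^+\cap\mathfrak k^-$ of radius at most $R$ that meets every geodesic from $\mathfrak h^-$ to $\mathfrak k^+$, and \emph{ball-separated} if this holds for some $R$. An \emph{$R$-chain} is a sequence of curtains $(\mathfrak h_i)$, indexed by an interval of $\mathbf Z$, such that $\mathfrak h_{i-1}\subseteq\mathfrak h_i^-$ and $\mathfrak h_{i+1}\subseteq\mathfrak h_i^+$ for all $i$, and $\mathfrak h_i,\mathfrak h_j$ are $R$-ball-separated for all $i<j$. \emph{The space $X$.} Each curtain induces two bipartitions (walls) of $S$, $\{\mathfrak h^-\cup\mathfrak h,\mathfrak h^+\}$ and $\{\mathfrak h^-,\mathfrak h\cup\mathfrak h^+\}$. Let $P$ be the set of all walls so obtained, and let $\mathcal C_R$ be the set of all families $\{h_i\}\subseteq P$ for which there is an $R$-chain $(\mathfrak h_i)$ with $\mathfrak h_i$ inducing $h_i$ for every $i$. An \emph{ultrafilter} $x$ chooses for every $h\in P$ one of its two halfspaces $x(h)$, in such a way that if $A\subseteq B$ are halfspaces of $h,k\in P$ and $x(h)=A$, then $x(k)=B$. Points of $S$ define ultrafilters, and isometries of $S$ act on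 ultrafilters. Put $d_R(x,y)=\sup\{|c|:c\in\mathcal C_R,\ x(h)\ne y(h)\text{ for all }h\in c\}$. Fix weights $\lambda_R>0$ $(R\ge1)$ with $\sum_R\lambda_R<\infty$, and let $X$ be the set of ultrafilters at finite distance from every point of $S$ with respect to $\mathrm D(x,y)=\sum_{R\ge1}\lambda_R d_R(x,y)$, equipped with $\mathrm D$. Let $g$ be an isometry of $S$ onto itself such that for every $s\in S$ the orbit map $n\mapsto g^ns$ is a $q$-quasiisometric embedding $\mathbf Z\to S$ for some $q$. Then the following are equivalent. \begin{enumerate} \item $g$ is \emph{strongly contracting}: there are $D,q$ and $s\in S$ such that $n\mapsto g^ns$ is a $q$-quasiisometric embedding and $\langle g\rangle s$ is $D$-strongly contracting. \item $g$ \emph{skewers} a pair of ball-separated curtains: there are ball-separated curtains $\mathfrak h,\mathfrak k$ and $n\in\mathbf Z$ with $g^n\mathfrak h^+\subsetneq\mathfrak k^+\subsetneq\mathfrak h^+$. \item $g$ \emph{acts loxodromically} on $X$: for some $x\in X$ the orbit map $n\mapsto g^nx$ is a quasiisometric embedding $\mathbf Z\to X$. \end{enumerate} -/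

import Mathlib

open Set
open scoped ENNReal

/-- `γ` restricted to `[0, ℓ]` is a geodesic of length `ℓ`. -/
def IsGeodesic {S : Type*} [MetricSpace S] (γ : ℝ → S) (ℓ : ℝ) : Prop :=
  0 ≤ ℓ ∧ ∀ t ∈ Icc 0 ℓ, ∀ u ∈ Icc 0 ℓ, dist (γ t) (γ u) = |t - u|

/-- Any two points are joined by a geodesic. -/
def IsGeodesicSpace (S : Type*) [MetricSpace S] : Prop :=
  ∀ x y : S, ∃ (γ : ℝ → S) (ℓ : ℝ), IsGeodesic γ ℓ ∧ γ 0 = x ∧ γ ℓ = y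

/-- The set of points of `α` that are closest to `x`. -/
def closestPoints {S : Type*} [MetricSpace S] (α : Set S) (x : S) : Set S :=
  {p | p ∈ α ∧ ∀ q ∈ α, dist x p ≤ dist x q}

/-- Closest-point projection to `α` sends every ball disjoint from `α` to a set of diameter less
than `D`. -/
def IsStronglyContractingSet {S : Type*} [MetricSpace S] (D : ℝ) (α : Set S) : Prop :=
  ∀ (x : S) (r : ℝ), 0 ≤ r → Disjoint (Metric.closedBall x r) α →
    Metric.ediam (⋃ y ∈ Metric.closedBall x r, closestPoints α y) < ENNReal.ofReal D

/-- An (oriented) curtain: a `D`-strongly contracting geodesic `path` of length `20 D`, `D ≥ 1`,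
with a subgeodesic `path [a, a + 10 D]` containing neither endpoint. The curtain itself is the set
`carrier` below; reversing `path` exchanges its two halfspaces `minus` and `plus`. -/
structure Curtain (S : Type*) [MetricSpace S] where
  D : ℝ
  one_le_D : 1 ≤ D
  path : ℝ → S
  isGeodesic : IsGeodesic path (20 * D)
  contracting : IsStronglyContractingSet D (path '' Icc 0 (20 * D))
  a : ℝ
  a_pos : 0 < a
  a_lt : a + 10 * D < 20 * D

namespace Curtain

variable {S : Type*} [MetricSpace S]

/-- The geodesic to which the curtain is dual. -/
def geod (h : Curtain S) : Set S := h.path '' Icc 0 (20 * h.D)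

/-- The curtain, as a subset of `S`. -/
def carrier (h : Curtain S) : Set S :=
  {x | closestPoints h.geod x ⊆ h.path '' Icc h.a (h.a + 10 * h.D)}

/-- The halfspace on the side of the initial component of the complement of the subgeodesic. -/
def minus (h : Curtain S) : Set S :=
  {x | (closestPoints h.geod x ∩ h.path '' Ico 0 h.a).Nonempty}

/-- The halfspace on the side of the final component of the complement of the subgeodesic. -/
def plus (h : Curtain S) : Set S :=
  {x | (closestPoints h.geod x ∩ h.path '' Ioc (h.a + 10 * h.D) (20 * h.D)).Nonempty}

/-- The two bipartitions of `S` induced by a curtain. -/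
def walls (h : Curtain S) : Set (Sym2 (Set S)) :=
  {s(h.minus ∪ h.carrier, h.plus), s(h.minus, h.carrier ∪ h.plus)}

lemma path_inj (h : Curtain S) {t u : ℝ} (ht : t ∈ Icc 0 (20 * h.D))
    (hu : u ∈ Icc 0 (20 * h.D)) (e : h.path t = h.path u) : t = u := by
  have := h.isGeodesic.2 t ht u hu
  rw [e, dist_self] at this
  exact sub_eq_zero.1 (abs_eq_zero.1 this.symm)

lemma union_eq_univ (h : Curtain S) : h.minus ∪ h.carrier ∪ h.plus = univ := by
  refine eq_univ_of_forall fun x => ?_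
  by_cases hx : x ∈ h.carrier
  · exact Or.inl (Or.inr hx)
  · obtain ⟨p, hp, hpn⟩ := not_subset.1 hx
    obtain ⟨t, ht, rfl⟩ := hp.1
    rcases lt_or_ge t h.a with h1 | h1
    · exact Or.inl (Or.inl ⟨_, hp, t, ⟨ht.1, h1⟩, rfl⟩)
    · rcases lt_or_ge (h.a + 10 * h.D) t with h2 | h2
      · exact Or.inr ⟨_, hp, t, ⟨h2, ht.2⟩, rfl⟩
      · exact absurd ⟨t, ⟨h1, h2⟩, rfl⟩ hpn

lemma disjoint_minus_carrier (h : Curtain S) : Disjoint h.minus h.carrier := by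
  rw [disjoint_left]
  rintro x ⟨p, hp, t, ht, rfl⟩ hx
  obtain ⟨u, hu, e⟩ := hx hp
  have h0 := h.a_pos
  have h1 := h.a_lt
  have h2 := h.one_le_D
  have := h.path_inj (t := u) (u := t) ⟨by linarith [hu.1], by linarith [hu.2]⟩
    ⟨ht.1, by linarith [ht.2]⟩ e
  linarith [hu.1, ht.2]

lemma disjoint_carrier_plus (h : Curtain S) : Disjoint h.carrier h.plus := by
  rw [disjoint_right]
  rintro x ⟨p, hp, t, ht, rfl⟩ hx
  obtain ⟨u, hu, e⟩ := hx hp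
  have h0 := h.a_pos
  have h1 := h.a_lt
  have h2 := h.one_le_D
  have := h.path_inj (t := u) (u := t) ⟨by linarith [hu.1], by linarith [hu.2]⟩
    ⟨by linarith [ht.1], ht.2⟩ e
  linarith [hu.2, ht.1]

lemma disjoint_minus_plus (h : Curtain S) : Disjoint h.minus h.plus := by
  rw [disjoint_left]
  rintro x ⟨p, hp, t, ht, rfl⟩ ⟨q, hq, u, hu, rfl⟩
  have h0 := h.a_pos
  have h1 := h.a_lt
  have h2 := h.one_le_D
  have hd : dist (h.path t) (h.path u) = |t - u| :=
    h.isGeodesic.2 t ⟨ht.1, by linarith [ht.2]⟩ u ⟨by linarith [hu.1], hu.2⟩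
  have hlt : 10 * h.D < dist (h.path t) (h.path u) := by
    rw [hd, abs_sub_comm]
    exact lt_of_lt_of_le (by linarith [hu.1, ht.2]) (le_abs_self _)
  by_cases hx : x ∈ h.geod
  · have e1 := hp.2 x hx
    have e2 := hq.2 x hx
    rw [dist_self] at e1 e2
    have := dist_triangle_left (h.path t) (h.path u) x
    linarith
  · have hdis : Disjoint (Metric.closedBall x 0) h.geod := by
      simpa [Metric.closedBall_zero] using hx
    have key := h.contracting x 0 le_rfl hdis
    have hm : ∀ z ∈ closestPoints h.geod x,
        z ∈ ⋃ y ∈ Metric.closedBall x 0, closestPoints (h.path '' Icc 0 (20 * h.D)) y :=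
      fun z hz => mem_iUnion₂.2 ⟨x, by simp, hz⟩
    have := (Metric.edist_le_ediam_of_mem (hm _ hp) (hm _ hq)).trans_lt key
    rw [edist_dist, ENNReal.ofReal_lt_ofReal_iff (by linarith)] at this
    linarith

lemma wall_eq (h : Curtain S) {w : Sym2 (Set S)} (hw : w ∈ h.walls) :
    ∃ A : Set S, w = s(A, Aᶜ) := by
  have h1 := h.union_eq_univ
  have h2 := h.disjoint_minus_carrier
  have h3 := h.disjoint_carrier_plus
  have h4 := h.disjoint_minus_plus
  rcases hw with rfl | rfl
  · refine ⟨h.minus ∪ h.carrier, ?_⟩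
    rw [IsCompl.compl_eq ⟨Disjoint.union_left h4 h3, codisjoint_iff.2 h1⟩]
  · refine ⟨h.minus, ?_⟩
    rw [IsCompl.compl_eq ⟨Disjoint.union_right h2 h4, codisjoint_iff.2 ?_⟩]
    exact (union_assoc _ _ _).symm.trans h1

/-- The disjoint curtains `h` and `k` (with `h` before `k`) are `R`-ball-separated. -/
def BallSeparated (R : ℕ) (h k : Curtain S) : Prop :=
  Disjoint h.carrier k.carrier ∧
    ∃ (x : S) (r : ℝ), 0 ≤ r ∧ r ≤ R ∧ Metric.closedBall x r ⊆ h.plus ∩ k.minus ∧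
      ∀ (γ : ℝ → S) (ℓ : ℝ), IsGeodesic γ ℓ → γ 0 ∈ h.minus → γ ℓ ∈ k.plus →
        ∃ t ∈ Icc 0 ℓ, γ t ∈ Metric.closedBall x r

/-- `g` skewers the pair `h, k`: `gⁿ h⁺ ⊊ k⁺ ⊊ h⁺` for some `n`. -/
def Skewers (g : S ≃ᵢ S) (h k : Curtain S) : Prop :=
  ∃ n : ℤ, (g ^ n : S ≃ᵢ S) '' h.plus ⊂ k.plus ∧ k.plus ⊂ h.plus

/-- A chain of curtains indexed by an interval of `ℤ`: the `j`-th curtain separates its two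
neighbours. -/
def IsChain {I : Set ℤ} (h : I → Curtain S) : Prop :=
  ∀ i j k : I, (j : ℤ) = i + 1 → (k : ℤ) = j + 1 →
    (h i).carrier ⊆ (h j).minus ∧ (h k).carrier ⊆ (h j).plus

/-- An `R`-chain: a chain of pairwise `R`-ball-separated curtains. -/
def IsRChain (R : ℕ) {I : Set ℤ} (h : I → Curtain S) : Prop :=
  IsChain h ∧ ∀ i j : I, i < j → BallSeparated R (h i) (h j)

end Curtain

/-- The set `P` of all bipartitions of `S` induced by curtains. -/
def curtainWalls (S : Type*) [MetricSpace S] : Set (Sym2 (Set S)) :=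
  ⋃ h : Curtain S, h.walls

/-- The system `C_R` of all sets of walls induced by `R`-chains of curtains (one wall for each
curtain of the chain). -/
def chainSystem (S : Type*) [MetricSpace S] (R : ℕ) : Set (Set (curtainWalls S)) :=
  {c | ∃ (I : Set ℤ) (h : I → Curtain S) (w : I → curtainWalls S),
    I.OrdConnected ∧ Curtain.IsRChain R h ∧ (∀ i, (w i : Sym2 (Set S)) ∈ (h i).walls) ∧
      c = range w}

/-- An ultrafilter on a set `P` of walls: a coherent choice of a halfspace of every wall. -/
@[ext]
structure WallUltrafilter {S : Type*} (P : Set (Sym2 (Set S))) where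
  side : P → Set S
  side_mem : ∀ h : P, side h ∈ (h : Sym2 (Set S))
  upward : ∀ h k : P, ∀ A ∈ (h : Sym2 (Set S)), ∀ B ∈ (k : Sym2 (Set S)),
    A ⊆ B → side h = A → side k = B

section Dual

variable {S : Type*} [MetricSpace S]

lemma curtainWalls_existsUnique (s : S) (h : curtainWalls S) :
    ∃! A : Set S, A ∈ (h : Sym2 (Set S)) ∧ s ∈ A := by
  obtain ⟨w, hw⟩ := h
  obtain ⟨k, hk⟩ := mem_iUnion.1 hw
  obtain ⟨A, rfl⟩ := k.wall_eq hk
  by_cases hs : s ∈ A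
  · refine ⟨A, ⟨by simp, hs⟩, ?_⟩
    rintro B ⟨hB, hsB⟩
    rcases Sym2.mem_iff.1 hB with rfl | rfl
    · rfl
    · exact absurd hs hsB
  · refine ⟨Aᶜ, ⟨by simp, hs⟩, ?_⟩
    rintro B ⟨hB, hsB⟩
    rcases Sym2.mem_iff.1 hB with rfl | rfl
    · exact absurd hsB hs
    · rfl

/-- The principal ultrafilter of a point: each wall is sent to its halfspace containing `s`. -/
noncomputable def principal (s : S) : WallUltrafilter (curtainWalls S) where
  side h := (curtainWalls_existsUnique s h).choose
  side_mem h := (curtainWalls_existsUnique s h).choose_spec.1.1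
  upward h k A _ B hB hAB e := by
    have h1 := (curtainWalls_existsUnique s h).choose_spec.1.2
    rw [e] at h1
    exact ((curtainWalls_existsUnique s k).choose_spec.2 B ⟨hB, hAB h1⟩).symm

lemma mem_principal_side (s : S) (h : curtainWalls S) : s ∈ (principal s).side h :=
  (curtainWalls_existsUnique s h).choose_spec.1.2

/-- `d_R(x, y)`: the supremum of the cardinalities of elements of `C_R` all of whose walls
separate `x` from `y`. -/
noncomputable def chainDist (R : ℕ) (x y : WallUltrafilter (curtainWalls S)) : ℕ∞ :=
  ⨆ c ∈ {c | c ∈ chainSystem S R ∧ ∀ h ∈ c, x.side h ≠ y.side h}, c.encard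

/-- `∑_{R ≥ 1} λ_R d_R(x, y)`. -/
noncomputable def gradedDist (lam : ℕ+ → ℝ) (x y : WallUltrafilter (curtainWalls S)) : ℝ≥0∞ :=
  ∑' R : ℕ+, ENNReal.ofReal (lam R) * (chainDist R x y : ℝ≥0∞)

/-- The graded dual `X` of `S` with weights `λ`: the ultrafilters at finite distance from `S`. -/
def gradedDual (S : Type*) [MetricSpace S] (lam : ℕ+ → ℝ) :
    Set (WallUltrafilter (curtainWalls S)) :=
  {x | ∀ s : S, gradedDist lam (principal s) x < ∞}

lemma closestPoints_image (g : S ≃ᵢ S) (α : Set S) (x : S) :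
    closestPoints (g '' α) (g x) = g '' closestPoints α x := by
  ext p
  constructor
  · rintro ⟨⟨q, hq, rfl⟩, hp⟩
    exact ⟨q, ⟨hq, fun r hr => by
      simpa only [g.dist_eq] using hp (g r) ⟨r, hr, rfl⟩⟩, rfl⟩
  · rintro ⟨q, ⟨hq, hp⟩, rfl⟩
    refine ⟨⟨q, hq, rfl⟩, ?_⟩
    rintro _ ⟨r, hr, rfl⟩
    simpa only [g.dist_eq] using hp r hr

/-- The translate of a curtain by an isometry. -/
def Curtain.map (g : S ≃ᵢ S) (h : Curtain S) : Curtain S where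
  D := h.D
  one_le_D := h.one_le_D
  path := g ∘ h.path
  isGeodesic := ⟨h.isGeodesic.1, fun t ht u hu => by
    simpa only [Function.comp_apply, g.dist_eq] using h.isGeodesic.2 t ht u hu⟩
  contracting := by
    intro x r hr hd
    obtain ⟨x, rfl⟩ := g.surjective x
    rw [image_comp, ← g.image_closedBall] at hd
    rw [image_comp, ← g.image_closedBall]
    have key := h.contracting x r hr ((disjoint_image_iff g.injective).1 hd)
    rw [biUnion_image]
    simp only [closestPoints_image]
    rw [← image_iUnion₂, g.isometry.ediam_image]
    exact key
  a := h.a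
  a_pos := h.a_pos
  a_lt := h.a_lt

lemma Curtain.map_geod (g : S ≃ᵢ S) (h : Curtain S) : (h.map g).geod = g '' h.geod :=
  image_comp g h.path (Icc 0 (20 * h.D))

lemma Curtain.map_carrier (g : S ≃ᵢ S) (h : Curtain S) : (h.map g).carrier = g '' h.carrier := by
  ext x
  obtain ⟨x, rfl⟩ := g.surjective x
  rw [g.injective.mem_set_image]
  change closestPoints (h.map g).geod (g x) ⊆ (g ∘ h.path) '' _ ↔ _
  rw [h.map_geod, closestPoints_image, image_comp, image_subset_image_iff g.injective]
  rfl

lemma Curtain.map_minus (g : S ≃ᵢ S) (h : Curtain S) : (h.map g).minus = g '' h.minus := by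
  ext x
  obtain ⟨x, rfl⟩ := g.surjective x
  rw [g.injective.mem_set_image]
  change (closestPoints (h.map g).geod (g x) ∩ (g ∘ h.path) '' _).Nonempty ↔ _
  rw [h.map_geod, closestPoints_image, image_comp, ← image_inter g.injective, image_nonempty]
  rfl

lemma Curtain.map_plus (g : S ≃ᵢ S) (h : Curtain S) : (h.map g).plus = g '' h.plus := by
  ext x
  obtain ⟨x, rfl⟩ := g.surjective x
  rw [g.injective.mem_set_image]
  change (closestPoints (h.map g).geod (g x) ∩ (g ∘ h.path) '' _).Nonempty ↔ _
  rw [h.map_geod, closestPoints_image, image_comp, ← image_inter g.injective, image_nonempty]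
  rfl

/-- The translate of a wall by an isometry. -/
def mapWall (g : S ≃ᵢ S) (h : curtainWalls S) : curtainWalls S :=
  ⟨Sym2.map (fun A => g '' A) h, by
    obtain ⟨w, hw⟩ := h
    obtain ⟨k, hk⟩ := mem_iUnion.1 hw
    refine mem_iUnion.2 ⟨k.map g, ?_⟩
    unfold Curtain.walls
    rw [k.map_minus, k.map_plus, k.map_carrier, ← image_union, ← image_union]
    rcases hk with rfl | rfl
    · exact Or.inl rfl
    · exact Or.inr rfl⟩

/-- The action of an isometry of `S` on ultrafilters: `(g x)(h) = g (x (g⁻¹ h))`. -/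
def WallUltrafilter.map (g : S ≃ᵢ S) (x : WallUltrafilter (curtainWalls S)) :
    WallUltrafilter (curtainWalls S) where
  side h := g '' x.side (mapWall g⁻¹ h)
  side_mem h := by
    obtain ⟨A, hA, e⟩ := Sym2.mem_map.1 (x.side_mem (mapWall g⁻¹ h))
    rw [← e, ← image_comp]
    have : (g ∘ (g⁻¹ : S ≃ᵢ S)) = id := funext fun s => g.apply_symm_apply s
    rw [this, image_id]
    exact hA
  upward h k A hA B hB hAB e := by
    have hg : ∀ C : Set S, g '' ((g⁻¹ : S ≃ᵢ S) '' C) = C := fun C => by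
      rw [← image_comp]
      have : (g ∘ (g⁻¹ : S ≃ᵢ S)) = id := funext fun s => g.apply_symm_apply s
      rw [this, image_id]
    have := x.upward (mapWall g⁻¹ h) (mapWall g⁻¹ k) ((g⁻¹ : S ≃ᵢ S) '' A)
      (Sym2.mem_map.2 ⟨A, hA, rfl⟩) ((g⁻¹ : S ≃ᵢ S) '' B) (Sym2.mem_map.2 ⟨B, hB, rfl⟩)
      (image_mono hAB) (g.injective.image_injective (by rw [hg]; exact e))
    rw [this, hg]

end Dual

/-- `f : ℤ → Y` is a `q`-quasiisometric embedding (a `q`-quasigeodesic) for the distance `d`. -/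
def IsQIEmbeddingWith {Y : Type*} (d : Y → Y → ℝ≥0∞) (q : ℝ) (f : ℤ → Y) : Prop :=
  1 ≤ q ∧ ∀ m n : ℤ, ENNReal.ofReal (|(m : ℝ) - n| / q - q) ≤ d (f m) (f n) ∧
    d (f m) (f n) ≤ ENNReal.ofReal (q * |(m : ℝ) - n| + q)

/-- Every orbit map `n ↦ gⁿ s` is a quasiisometric embedding of `ℤ` in `S`. -/
def HasQIEmbeddedOrbits {S : Type*} [MetricSpace S] (g : S ≃ᵢ S) : Prop :=
  ∀ s : S, ∃ q : ℝ, IsQIEmbeddingWith edist q fun n : ℤ => (g ^ n : S ≃ᵢ S) s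

/-- Some orbit of `⟨g⟩` is a strongly contracting quasigeodesic. -/
def IsStronglyContractingIsometry {S : Type*} [MetricSpace S] (g : S ≃ᵢ S) : Prop :=
  ∃ (D q : ℝ) (s : S), (IsQIEmbeddingWith edist q fun n : ℤ => (g ^ n : S ≃ᵢ S) s) ∧
    IsStronglyContractingSet D (range fun n : ℤ => (g ^ n : S ≃ᵢ S) s)

/-- `g` acts loxodromically on the graded dual `X`: its orbits in `X` are quasiisometrically
embedded copies of `ℤ`. -/
def ActsLoxodromically {S : Type*} [MetricSpace S] (lam : ℕ+ → ℝ) (g : S ≃ᵢ S) : Prop :=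
  ∃ x ∈ gradedDual S lam, ∃ q : ℝ,
    IsQIEmbeddingWith (gradedDist lam) q fun n : ℤ => x.map (g ^ n : S ≃ᵢ S)

/-! ### Strongly contracting sets: far geodesics, close geodesics, and gates. -/

section Contracting

variable {S : Type*} [MetricSpace S] {D : ℝ} {Z : Set S} {γ : ℝ → S} {ℓ : ℝ}

/-! Everything passes through one condition: some translate of a curtain `k` by a power of `g` lies
strictly beyond it, `Before k (k.map (g ^ n))`. It is equivalent to skewering. Iterating it gives a
bi-infinite nested family of curtains of equal thickness `D`, and members far apart in such a family
are automatically ball-separated. Indeed, every geodesic crossing a curtain passes within `24 * D`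
of a point of its pole, the geodesic it is dual to (`exists_dist_le`), while nested curtains add up
their thicknesses (`sum_le_dist`), so that the ball about this point fits between two curtains of
the family.

Skewering implies loxodromic: for a single `R` the chain distance `d_R` grows linearly along an
orbit, which bounds `D` below; `d_R ≤ dist + 2` for every `R`, together with summability of the
weights, bounds it above.

Loxodromic implies contracting: linear growth of the weighted sum yields, for each pair of orbit
points, some `R` with a chain of linear length separating them. This `R` is not controlled, and it
is not used: only nesting matters. The total thickness of the chain is at most linear, so by
averaging many of its curtains are thin and have poles near the orbit. Such curtains are gates,
narrow passages that geodesics from one side to the other can be forced through. Four gates near a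
set, suitably spread out, prevent a ball missing the set from having a large projection
(`HasGates.not_close`), so the orbit is strongly contracting.

Contracting implies skewering: a geodesic whose ends project far apart on the orbit passes close to
the orbit points in between (`exists_passesClose`), so these are again gates. Hence a long geodesic
between orbit points has a strongly contracting initial segment. A curtain dual to it is crossed by
the orbit, and a large power of `g` moves it beyond itself. -/

lemma infDist_eq_of_mem_closestPoints {x p : S} (hp : p ∈ closestPoints Z x) :
    Metric.infDist x Z = dist x p :=
  le_antisymm (Metric.infDist_le_dist_of_mem hp.1)
    ((Metric.le_infDist ⟨p, hp.1⟩).2 fun _ hz => hp.2 _ hz)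

lemma closestPoints_nonempty_of_isCompact (hZ : IsCompact Z) (hne : Z.Nonempty) (x : S) :
    (closestPoints Z x).Nonempty := by
  obtain ⟨p, hp, e⟩ := hZ.exists_infDist_eq_dist hne x
  exact ⟨p, hp, fun q hq => e ▸ Metric.infDist_le_dist_of_mem hq⟩

lemma mem_closestPoints_self {x : S} (hx : x ∈ Z) : x ∈ closestPoints Z x :=
  ⟨hx, fun _ _ => by rw [dist_self]; exact dist_nonneg⟩

lemma eq_of_mem_closestPoints {x p : S} (hx : x ∈ Z) (hp : p ∈ closestPoints Z x) : p = x := by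
  have := hp.2 x hx
  rw [dist_self] at this
  exact (dist_le_zero.1 this).symm

/-- Moving towards a closest point does not create new closest points. -/
lemma closestPoints_subset_of_between {x y p : S} (hp : p ∈ closestPoints Z x)
    (h : dist x y + dist y p = dist x p) : closestPoints Z y ⊆ closestPoints Z x := by
  intro q hq
  refine ⟨hq.1, fun r hr => ?_⟩
  linarith [dist_triangle x y q, hq.2 p hp.1, hp.2 r hr]

lemma IsGeodesic.continuousOn (hγ : IsGeodesic γ ℓ) : ContinuousOn γ (Icc 0 ℓ) := by
  refine (LipschitzOnWith.of_dist_le_mul (K := 1) fun t ht u hu => ?_).continuousOn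
  rw [hγ.2 t ht u hu, NNReal.coe_one, one_mul, Real.dist_eq]

lemma IsGeodesic.dist_eq (hγ : IsGeodesic γ ℓ) {t u : ℝ} (ht : 0 ≤ t) (htu : t ≤ u) (hu : u ≤ ℓ) :
    dist (γ t) (γ u) = u - t := by
  rw [hγ.2 t ⟨ht, htu.trans hu⟩ u ⟨ht.trans htu, hu⟩, abs_sub_comm, abs_of_nonneg (by linarith)]

lemma IsGeodesic.initial (hγ : IsGeodesic γ ℓ) {t : ℝ} (ht : t ∈ Icc 0 ℓ) : IsGeodesic γ t :=
  ⟨ht.1, fun u hu v hv => hγ.2 u ⟨hu.1, hu.2.trans ht.2⟩ v ⟨hv.1, hv.2.trans ht.2⟩⟩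

lemma IsGeodesic.subpath (hγ : IsGeodesic γ ℓ) {t u : ℝ} (ht : 0 ≤ t) (htu : t ≤ u) (hu : u ≤ ℓ) :
    IsGeodesic (fun v => γ (t + v)) (u - t) := by
  refine ⟨by linarith, fun v hv w hw => ?_⟩
  rw [hγ.2 _ ⟨by linarith [hv.1], by linarith [hv.2]⟩ _ ⟨by linarith [hw.1], by linarith [hw.2]⟩]
  congr 1
  ring

lemma isStronglyContractingSet_mono {D' : ℝ} (h : D ≤ D') (hZ : IsStronglyContractingSet D Z) :
    IsStronglyContractingSet D' Z :=
  fun x r hr hd => (hZ x r hr hd).trans_le (ENNReal.ofReal_le_ofReal h)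

lemma IsStronglyContractingSet.dist_lt (hZ : IsStronglyContractingSet D Z) {x y y' p q : S} {r : ℝ}
    (hr : 0 ≤ r) (h : r < Metric.infDist x Z) (hy : dist x y ≤ r) (hy' : dist x y' ≤ r)
    (hp : p ∈ closestPoints Z y) (hq : q ∈ closestPoints Z y') : dist p q < D := by
  have hd : Disjoint (Metric.closedBall x r) Z := by
    rw [disjoint_left]
    intro z hz hzZ
    have := Metric.infDist_le_dist_of_mem (x := x) hzZ
    rw [Metric.mem_closedBall, dist_comm] at hz
    linarith
  have key := hZ x r hr hd
  rw [← edist_lt_ofReal]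
  refine (Metric.edist_le_ediam_of_mem ?_ ?_).trans_lt key
  · exact mem_iUnion₂.2 ⟨y, by rwa [Metric.mem_closedBall, dist_comm], hp⟩
  · exact mem_iUnion₂.2 ⟨y', by rwa [Metric.mem_closedBall, dist_comm], hq⟩

/-- A piece of length `3 * D` lies in a ball missing `Z`, so projection shrinks length by a factor
of three, up to one extra step. The factor must exceed one for the bootstrap in `dist_le_of_far`. -/
lemma IsStronglyContractingSet.dist_le_of_steps (hD : 0 < D) (hZ : IsStronglyContractingSet D Z)
    (hne : ∀ x, (closestPoints Z x).Nonempty) (hγ : IsGeodesic γ ℓ) (n : ℕ) :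
    ∀ t₁ t₂ : ℝ, 0 ≤ t₁ → t₁ ≤ t₂ → t₂ ≤ ℓ → (∀ t ∈ Icc t₁ t₂, 4 * D ≤ Metric.infDist (γ t) Z) →
      t₂ - t₁ ≤ (n + 1) * (3 * D) → ∀ p ∈ closestPoints Z (γ t₁), ∀ q ∈ closestPoints Z (γ t₂),
        dist p q ≤ (n + 1) * D := by
  have base : ∀ t₁ t₂ : ℝ, 0 ≤ t₁ → t₁ ≤ t₂ → t₂ ≤ ℓ →
      (∀ t ∈ Icc t₁ t₂, 4 * D ≤ Metric.infDist (γ t) Z) →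
      t₂ - t₁ ≤ 3 * D → ∀ p ∈ closestPoints Z (γ t₁), ∀ q ∈ closestPoints Z (γ t₂),
        dist p q ≤ D := by
    intro t₁ t₂ h0 h12 h2 hf hs p hp q hq
    have h4 := hf t₁ ⟨le_rfl, h12⟩
    refine (hZ.dist_lt (r := 3 * D) (by linarith) (by linarith) ?_ ?_ hp hq).le
    · rw [dist_self]; linarith
    · rw [hγ.dist_eq h0 h12 h2]; exact hs
  induction n with
  | zero =>
    intro t₁ t₂ h0 h12 h2 hf hs p hp q hq
    simpa using base t₁ t₂ h0 h12 h2 hf (by simpa using hs) p hp q hq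
  | succ n ih =>
    intro t₁ t₂ h0 h12 h2 hf hs p hp q hq
    push_cast at hs ⊢
    have hn : (0 : ℝ) ≤ n * D := by positivity
    rcases le_or_gt (t₂ - t₁) (3 * D) with h | h
    · linarith [base t₁ t₂ h0 h12 h2 hf h p hp q hq]
    · obtain ⟨m, hm⟩ := hne (γ (t₁ + 3 * D))
      have e1 := base t₁ (t₁ + 3 * D) h0 (by linarith) (by linarith)
        (fun t ht => hf t ⟨ht.1, by linarith [ht.2]⟩) (by linarith) p hp m hm
      have e2 := ih (t₁ + 3 * D) t₂ (by linarith) (by linarith) h2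
        (fun t ht => hf t ⟨by linarith [ht.1], ht.2⟩) (by linarith) m hm q hq
      linarith [dist_triangle p m q]

/-- A geodesic far from a strongly contracting set has bounded projection to it. -/
lemma IsStronglyContractingSet.dist_le_of_far (hD : 0 < D) (hZ : IsStronglyContractingSet D Z)
    (hne : ∀ x, (closestPoints Z x).Nonempty) (hγ : IsGeodesic γ ℓ) {t₁ t₂ : ℝ} (h0 : 0 ≤ t₁)
    (h12 : t₁ ≤ t₂) (h2 : t₂ ≤ ℓ) (hf : ∀ t ∈ Icc t₁ t₂, 4 * D ≤ Metric.infDist (γ t) Z)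
    {p q : S} (hp : p ∈ closestPoints Z (γ t₁)) (hq : q ∈ closestPoints Z (γ t₂)) :
    dist p q ≤ 5 * D := by
  have ha := infDist_eq_of_mem_closestPoints hp
  have hb := infDist_eq_of_mem_closestPoints hq
  have ha4 := hf t₁ ⟨le_rfl, h12⟩
  have hb4 := hf t₂ ⟨h12, le_rfl⟩
  set a := Metric.infDist (γ t₁) Z
  set b := Metric.infDist (γ t₂) Z
  have hl : t₂ - t₁ ≤ a + dist p q + b := by
    rw [← hγ.dist_eq h0 h12 h2, ha, hb, dist_comm (γ t₂)]
    exact dist_triangle4 _ _ _ _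
  have left : ∀ u, t₁ ≤ u → u ≤ t₂ → u - t₁ ≤ a - D / 2 → ∀ m ∈ closestPoints Z (γ u),
      dist p m < D := fun u hu hu2 hs m hm =>
    hZ.dist_lt (x := γ t₁) (r := a - D / 2) (by linarith) (by change _ < a; linarith)
      (by rw [dist_self]; linarith) (by rw [hγ.dist_eq h0 hu (by linarith)]; exact hs) hp hm
  have right : ∀ u, t₁ ≤ u → u ≤ t₂ → t₂ - u ≤ b - D / 2 → ∀ m ∈ closestPoints Z (γ u),
      dist m q < D := fun u hu hu2 hs m hm =>
    hZ.dist_lt (x := γ t₂) (r := b - D / 2) (by linarith) (by change _ < b; linarith)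
      (by rw [dist_comm, hγ.dist_eq (by linarith) hu2 h2]; exact hs)
      (by rw [dist_self]; linarith) hm hq
  -- The balls of radii `a - D / 2` and `b - D / 2` about the endpoints each have projection smaller
  -- than `D`. If they do not cover the geodesic, the remaining middle has length at most `dist p q
  -- + D` and projects to at most `(dist p q + D) / 3 + D`. Hence `dist p q ≤ 3 * D + (dist p q + D)
  -- / 3`, that is, `dist p q ≤ 5 * D`.
  rcases le_or_gt (t₂ - t₁) (a + b - D) with h | h
  · rcases le_total (t₁ + a - D / 2) t₂ with h' | h'
    · obtain ⟨m, hm⟩ := hne (γ (t₁ + a - D / 2))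
      linarith [left _ (by linarith) h' (by linarith) m hm,
        right _ (by linarith) h' (by linarith) m hm, dist_triangle p m q]
    · linarith [left t₂ h12 le_rfl (by linarith) q hq]
  · obtain ⟨m, hm⟩ := hne (γ (t₁ + a - D / 2))
    obtain ⟨m', hm'⟩ := hne (γ (t₂ - b + D / 2))
    have e1 := left _ (by linarith) (by linarith) (by linarith) m hm
    have e2 := right _ (by linarith) (by linarith) (by linarith) m' hm'
    have hpos : 0 < 3 * D := by linarith
    have hnn : 0 ≤ (dist p q + D) / (3 * D) := by positivity
    have f1 := (Nat.lt_floor_add_one ((dist p q + D) / (3 * D))).le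
    have f2 := Nat.floor_le hnn
    rw [div_le_iff₀ hpos] at f1
    rw [le_div_iff₀ hpos] at f2
    have e3 := hZ.dist_le_of_steps hD hne hγ ⌊(dist p q + D) / (3 * D)⌋₊
      (t₁ + a - D / 2) (t₂ - b + D / 2) (by linarith) (by linarith) (by linarith)
      (fun t ht => hf t ⟨by linarith [ht.1], by linarith [ht.2]⟩) (by linarith) m hm m' hm'
    linarith [dist_triangle4 p m m' q]

/-- A geodesic stays close to a strongly contracting set between two visits to it. -/
lemma IsStronglyContractingSet.infDist_le_of_between (hD : 0 < D)
    (hZ : IsStronglyContractingSet D Z) (hne : ∀ x, (closestPoints Z x).Nonempty)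
    (hγ : IsGeodesic γ ℓ) {t₁ t t₂ : ℝ} (h0 : 0 ≤ t₁) (h1 : t₁ ≤ t) (h2 : t ≤ t₂) (h3 : t₂ ≤ ℓ)
    (n1 : Metric.infDist (γ t₁) Z ≤ 4 * D) (n2 : Metric.infDist (γ t₂) Z ≤ 4 * D) :
    Metric.infDist (γ t) Z ≤ 11 * D := by
  rcases le_or_gt (Metric.infDist (γ t) Z) (4 * D) with ht | ht
  · linarith
  set f : ℝ → ℝ := fun u => Metric.infDist (γ u) Z with hf
  have hlip : ∀ u v, 0 ≤ u → u ≤ v → v ≤ ℓ → f u ≤ f v + (v - u) ∧ f v ≤ f u + (v - u) := by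
    intro u v hu huv hv
    rw [← hγ.dist_eq hu huv hv]
    refine ⟨Metric.infDist_le_infDist_add_dist, ?_⟩
    rw [dist_comm]
    exact Metric.infDist_le_infDist_add_dist
  have hc : ContinuousOn f (Icc 0 ℓ) :=
    (Metric.continuous_infDist_pt Z).comp_continuousOn hγ.continuousOn
  have hcl : ∀ a b, 0 ≤ a → b ≤ ℓ → IsCompact {u ∈ Icc a b | f u ≤ 4 * D} := fun a b ha hb =>
    isCompact_Icc.of_isClosed_subset
      ((hc.mono (Icc_subset_Icc ha hb)).preimage_isClosed_of_isClosed isClosed_Icc isClosed_Iic)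
      fun _ hu => hu.1
  obtain ⟨m₁, hm₁, g₁⟩ := (hcl t₁ t h0 (by linarith)).exists_isGreatest ⟨t₁, ⟨le_rfl, h1⟩, n1⟩
  obtain ⟨m₂, hm₂, g₂⟩ := (hcl t t₂ (by linarith) h3).exists_isLeast ⟨t₂, ⟨h2, le_rfl⟩, n2⟩
  have hlt1 : m₁ < t := lt_of_le_of_ne hm₁.1.2 fun e => by
    have := hm₁.2; rw [e] at this; exact absurd this (not_le.2 ht)
  have hlt2 : t < m₂ := lt_of_le_of_ne hm₂.1.1 fun e => by
    have := hm₂.2; rw [← e] at this; exact absurd this (not_le.2 ht)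
  have b1 := hm₁.1.1
  have b2 := hm₂.1.2
  -- Were the value smaller, the last visit before `t` could be postponed, since `f` is 1-Lipschitz.
  have e1 : 4 * D ≤ f m₁ := by
    by_contra! h
    have hu : m₁ < min (m₁ + (4 * D - f m₁)) t := lt_min (by linarith) hlt1
    have hl := (hlip m₁ (min (m₁ + (4 * D - f m₁)) t) (by linarith) hu.le
      ((min_le_right _ _).trans (by linarith))).2
    have := g₁ ⟨⟨by linarith, min_le_right _ _⟩,
      show f _ ≤ 4 * D by linarith [min_le_left (m₁ + (4 * D - f m₁)) t]⟩
    linarith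
  have e2 : 4 * D ≤ f m₂ := by
    by_contra! h
    have hu : max (m₂ - (4 * D - f m₂)) t < m₂ := max_lt (by linarith) hlt2
    have ht0 := le_max_right (m₂ - (4 * D - f m₂)) t
    have hl := (hlip (max (m₂ - (4 * D - f m₂)) t) m₂ (by linarith) hu.le (by linarith)).1
    have := g₂ ⟨⟨le_max_right _ _, by linarith⟩,
      show f _ ≤ 4 * D by linarith [le_max_left (m₂ - (4 * D - f m₂)) t]⟩
    linarith
  have far : ∀ u ∈ Icc m₁ m₂, 4 * D ≤ f u := by
    intro u hu
    by_contra! h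
    rcases le_total u t with hut | hut
    · have := g₁ ⟨⟨by linarith [hu.1], hut⟩, h.le⟩
      rw [le_antisymm this hu.1] at h
      linarith
    · have := g₂ ⟨⟨hut, by linarith [hu.2]⟩, h.le⟩
      rw [le_antisymm hu.2 this] at h
      linarith
  obtain ⟨p, hp⟩ := hne (γ m₁)
  obtain ⟨q, hq⟩ := hne (γ m₂)
  have key := hZ.dist_le_of_far hD hne hγ (by linarith) (by linarith) (by linarith) far hp hq
  have i1 := infDist_eq_of_mem_closestPoints hp
  have i2 := infDist_eq_of_mem_closestPoints hq
  -- The excursion has length at most `4 * D + 5 * D + 4 * D`, so `γ t` is within `6.5 * D` of one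
  -- of its ends, whence the bound `11 * D`.
  have hl : m₂ - m₁ ≤ 13 * D := by
    rw [← hγ.dist_eq (by linarith) (by linarith) (by linarith : m₂ ≤ ℓ)]
    have := dist_triangle4 (γ m₁) p q (γ m₂)
    rw [dist_comm q] at this
    have j1 := hm₁.2
    have j2 := hm₂.2
    simp only [hf] at j1 j2
    linarith
  have k1 := (hlip m₁ t (by linarith) hlt1.le (by linarith)).2
  have k2 := (hlip t m₂ (by linarith) hlt2.le (by linarith)).1
  have j1 := hm₁.2
  have j2 := hm₂.2
  change f t ≤ _
  linarith

/-- A property that holds at the start of an interval and fails at its end is lost within a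
subinterval of length at most one. -/
lemma exists_transition {P : ℝ → Prop} {a b : ℝ} (hab : a ≤ b) (ha : P a) (hb : ¬ P b) :
    ∃ t u, a ≤ t ∧ t ≤ u ∧ u ≤ b ∧ u ≤ t + 1 ∧ P t ∧ ¬ P u := by
  obtain ⟨n, hn⟩ := exists_nat_ge (b - a)
  induction n generalizing a with
  | zero => exact ⟨a, b, le_rfl, hab, le_rfl, by push_cast at hn; linarith, ha, hb⟩
  | succ n ih =>
    push_cast at hn
    rcases le_or_gt b (a + 1) with h | h
    · exact ⟨a, b, le_rfl, hab, le_rfl, h, ha, hb⟩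
    · by_cases hP : P (a + 1)
      · obtain ⟨t, u, h1, h2⟩ := ih h.le hP (by linarith)
        exact ⟨t, u, by linarith, h2⟩
      · exact ⟨a, a + 1, le_rfl, by linarith, h.le, le_rfl, ha, hP⟩

/-- Every two points of `U` and `V` are joined by a geodesic passing through the ball of radius
`R` about `c`. -/
def IsGate (R : ℝ) (U V : Set S) (c : S) : Prop :=
  ∀ x ∈ U, ∀ y ∈ V, ∃ z, dist x z + dist z y = dist x y ∧ dist z c ≤ R

/-- The points `p` and `q` are separated by four consecutive gates close to `Z` and far from each
other. -/
def HasGates (Z : Set S) (R : ℝ) (p q : S) : Prop :=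
  ∃ (U V : ℕ → Set S) (c : ℕ → S), (∀ i < 4, IsGate R (U i) (V i) (c i)) ∧
    (∀ i < 4, ∃ w ∈ Z, dist w (c i) ≤ R) ∧ (∀ i j, i < j → j < 4 → (V i)ᶜ ⊆ U j) ∧
    p ∈ U 0 ∧ q ∈ V 3 ∧ 3 * R < dist p (c 0) ∧ 3 * R < dist q (c 3) ∧ 6 * R < dist (c 1) (c 2)

/-- The outer gates place `x` and `y`: if `x` were in `V 0`, the way from `x` to `p` would pass near
`c 0`, hence near a point of `Z` closer to `x` than `p`; symmetrically for `y` and `c 3`. By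
nesting, the ways from `x` to `y` pass the two inner gates, within `2 * R` of `Z`. If the ball about
`x` misses `Z`, both passages occur within `2 * R` of `y`, which puts `c 1` and `c 2` within `6 * R`
of each other. -/
lemma HasGates.not_close {R r : ℝ} {p q x y : S} (h : HasGates Z R p q)
    (hp : p ∈ closestPoints Z x) (hq : q ∈ closestPoints Z y) (hxy : dist x y ≤ r)
    (hr : (∀ z ∈ Z, r < dist x z) ∨ ∀ z ∈ Z, r < dist y z) : False := by
  obtain ⟨U, V, c, hg, hw, hn, hpU, hqV, hpc, hqc, hcc⟩ := h
  have hx : x ∉ V 0 := by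
    intro hx
    obtain ⟨z, hz, hzc⟩ := hg 0 (by norm_num) p hpU x hx
    obtain ⟨w, hwZ, hwc⟩ := hw 0 (by norm_num)
    have := hp.2 w hwZ
    linarith [dist_triangle4 x z (c 0) w, dist_triangle p z (c 0), dist_comm p x, dist_comm z x,
      dist_comm w (c 0)]
  have hy : y ∉ U 3 := by
    intro hy
    obtain ⟨z, hz, hzc⟩ := hg 3 (by norm_num) y hy q hqV
    obtain ⟨w, hwZ, hwc⟩ := hw 3 (by norm_num)
    have := hq.2 w hwZ
    linarith [dist_triangle4 y z (c 3) w, dist_triangle q z (c 3), dist_comm q z,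
      dist_comm w (c 3)]
  have key : ∀ i, 0 < i → i < 3 → ∃ w ∈ Z, ∃ z, dist x z + dist z y = dist x y ∧
      dist z (c i) ≤ R ∧ dist w (c i) ≤ R := by
    intro i h0 h3
    obtain ⟨z, hz, hzc⟩ := hg i (by omega) x (hn 0 i h0 (by omega) hx) y
      (by by_contra hyi; exact hy (hn i 3 h3 (by norm_num) hyi))
    obtain ⟨w, hwZ, hwc⟩ := hw i (by omega)
    exact ⟨w, hwZ, z, hz, hzc, hwc⟩
  obtain ⟨w, hw1, z, hz1, hzc1, hwc1⟩ := key 1 (by norm_num) (by norm_num)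
  obtain ⟨w', hw2, z', hz2, hzc2, hwc2⟩ := key 2 (by norm_num) (by norm_num)
  rcases hr with hr | hr
  · have := hr w hw1
    have := hr w' hw2
    linarith [dist_triangle4 x z (c 1) w, dist_triangle4 x z' (c 2) w', dist_comm w (c 1),
      dist_comm w' (c 2), dist_triangle4 (c 1) z y (c 2), dist_triangle y z' (c 2),
      dist_comm (c 1) z, dist_comm y z']
  · have := hr w hw1
    have := hr w' hw2
    linarith [dist_triangle4 y z (c 1) w, dist_triangle4 y z' (c 2) w', dist_comm w (c 1),
      dist_comm w' (c 2), dist_triangle4 (c 1) z x (c 2), dist_triangle x z' (c 2),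
      dist_comm (c 1) z, dist_comm y z', dist_comm y z, dist_comm x z]

/-- A set any two distant points of which are separated by gates is strongly contracting. -/
lemma isStronglyContractingSet_of_hasGates {R L : ℝ} (hL : 0 ≤ L)
    (hne : ∀ x, (closestPoints Z x).Nonempty)
    (h : ∀ p ∈ Z, ∀ q ∈ Z, L < dist p q → HasGates Z R p q ∨ HasGates Z R q p) :
    IsStronglyContractingSet (2 * L + 1) Z := by
  intro x r _ hd
  have hfar : ∀ z ∈ Z, r < dist x z := by
    intro z hz
    by_contra! hle
    exact disjoint_left.1 hd (by rwa [Metric.mem_closedBall, dist_comm]) hz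
  obtain ⟨p, hp⟩ := hne x
  have key : ∀ y ∈ Metric.closedBall x r, ∀ q ∈ closestPoints Z y, dist p q ≤ L := by
    intro y hy q hq
    by_contra! hlt
    rw [Metric.mem_closedBall] at hy
    rcases h p hp.1 q hq.1 hlt with hG | hG
    · exact hG.not_close hp hq (by rwa [dist_comm]) (Or.inl hfar)
    · exact hG.not_close hq hp hy (Or.inr hfar)
  refine lt_of_le_of_lt (b := ENNReal.ofReal (2 * L)) (Metric.ediam_le ?_)
    ((ENNReal.ofReal_lt_ofReal_iff (by linarith)).2 (by linarith))
  intro a ha b hb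
  obtain ⟨y, hy, hya⟩ := mem_iUnion₂.1 ha
  obtain ⟨y', hy', hyb⟩ := mem_iUnion₂.1 hb
  rw [edist_dist]
  refine ENNReal.ofReal_le_ofReal ?_
  linarith [key y hy a hya, key y' hy' b hyb, dist_triangle_left a b p]

end Contracting

/-! ### Geometry of a single curtain: thickness, bottleneck, connectedness. -/

namespace Curtain

variable {S : Type*} [MetricSpace S]

lemma D_pos (h : Curtain S) : 0 < h.D := one_pos.trans_le h.one_le_D

lemma geod_nonempty (h : Curtain S) : h.geod.Nonempty :=
  ⟨h.path 0, 0, ⟨le_rfl, h.isGeodesic.1⟩, rfl⟩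

lemma closestPoints_nonempty (h : Curtain S) (x : S) : (closestPoints h.geod x).Nonempty :=
  closestPoints_nonempty_of_isCompact (isCompact_Icc.image_of_continuousOn
    h.isGeodesic.continuousOn) h.geod_nonempty x

lemma exists_closestPoints (h : Curtain S) {x y : S} (hx : x ∈ h.minus) (hy : y ∈ h.plus) :
    ∃ p ∈ closestPoints h.geod x, ∃ q ∈ closestPoints h.geod y, 10 * h.D < dist p q := by
  obtain ⟨p, hp, t, ht, rfl⟩ := hx
  obtain ⟨q, hq, u, hu, rfl⟩ := hy
  refine ⟨_, hp, _, hq, ?_⟩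
  have := h.D_pos
  have := h.a_lt
  rw [h.isGeodesic.dist_eq ht.1 (by linarith [ht.2, hu.1]) hu.2]
  linarith [ht.2, hu.1]

/-- Curtains are thick. -/
lemma lt_dist (h : Curtain S) {x y : S} (hx : x ∈ h.minus) (hy : y ∈ h.plus) :
    3 * h.D < dist x y := by
  obtain ⟨p, hp, q, hq, hpq⟩ := h.exists_closestPoints hx hy
  have hD := h.D_pos
  have hp' := infDist_eq_of_mem_closestPoints hp
  have hq' := infDist_eq_of_mem_closestPoints hq
  -- Otherwise the ball about `x` reaching to `y` misses the pole, and the projections `p`, `q`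
  -- differ by less than `D`. With `e2`, the path `p`, `x`, `y`, `q` gives `10 * D < 3 * dist x y`.
  have e1 : dist x p ≤ dist x y := by
    by_contra! hlt
    have := h.contracting.dist_lt (x := x) (dist_nonneg (x := x) (y := y)) (hp'.symm ▸ hlt)
      (by rw [dist_self]; exact dist_nonneg) le_rfl hp hq
    linarith
  have e2 : dist y q ≤ dist x y := by
    by_contra! hlt
    have := h.contracting.dist_lt (x := y) (dist_nonneg (x := x) (y := y)) (hq'.symm ▸ hlt)
      (by rw [dist_comm]) (by rw [dist_self]; exact dist_nonneg) hp hq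
    linarith
  linarith [dist_triangle4 p x y q, dist_comm p x]

lemma path_a_mem_carrier (h : Curtain S) : h.path h.a ∈ h.carrier := by
  have := h.D_pos
  have := h.a_pos
  have := h.a_lt
  intro p hp
  have hm : h.path h.a ∈ h.geod := ⟨h.a, ⟨by linarith, by linarith⟩, rfl⟩
  rw [eq_of_mem_closestPoints hm hp]
  exact ⟨h.a, ⟨le_rfl, by linarith⟩, rfl⟩

lemma minus_nonempty (h : Curtain S) : h.minus.Nonempty :=
  ⟨h.path 0, h.path 0, mem_closestPoints_self ⟨0, ⟨le_rfl, h.isGeodesic.1⟩, rfl⟩, 0,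
    ⟨le_rfl, h.a_pos⟩, rfl⟩

lemma plus_nonempty (h : Curtain S) : h.plus.Nonempty :=
  ⟨h.path (20 * h.D), h.path (20 * h.D),
    mem_closestPoints_self ⟨20 * h.D, ⟨h.isGeodesic.1, le_rfl⟩, rfl⟩, 20 * h.D,
    ⟨h.a_lt, le_rfl⟩, rfl⟩

/-- Every geodesic crossing a curtain passes close to its pole. -/
lemma exists_dist_le (h : Curtain S) {γ : ℝ → S} {ℓ : ℝ} (hγ : IsGeodesic γ ℓ)
    (h0 : γ 0 ∈ h.minus) (hℓ : γ ℓ ∈ h.plus) :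
    ∃ t ∈ Icc 0 ℓ, dist (γ t) (h.path h.a) ≤ 24 * h.D := by
  have hD := h.D_pos
  have ha := h.a_pos
  have ha' := h.a_lt
  obtain ⟨p, hp, q, hq, hpq⟩ := h.exists_closestPoints h0 hℓ
  by_contra! hcon
  -- The pole has length `20 * D`, so a geodesic avoiding the `24 * D`-ball about one of its points
  -- stays `4 * D` away from all of it, and projects to at most `5 * D` rather than the `10 * D`
  -- needed to cross.
  have := IsStronglyContractingSet.dist_le_of_far (Z := h.geod) hD h.contracting
    h.closestPoints_nonempty hγ le_rfl hγ.1 le_rfl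
    (fun t ht => by
      by_contra! hlt
      obtain ⟨r, hr⟩ := h.closestPoints_nonempty (γ t)
      rw [infDist_eq_of_mem_closestPoints hr] at hlt
      obtain ⟨u, hu, rfl⟩ := hr.1
      have h1 := hcon t ht
      have h2 : dist (h.path u) (h.path h.a) ≤ 20 * h.D := by
        rw [h.isGeodesic.2 u hu _ ⟨ha.le, by linarith⟩, abs_le]
        constructor <;> linarith [hu.1, hu.2]
      linarith [dist_triangle (γ t) (h.path u) (h.path h.a)]) hp hq
  linarith

lemma isGate (hS : IsGeodesicSpace S) (h : Curtain S) {R : ℝ} (hR : 24 * h.D ≤ R) :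
    IsGate R h.minus h.plus (h.path h.a) := by
  intro x hx y hy
  obtain ⟨γ, ℓ, hγ, rfl, rfl⟩ := hS x y
  obtain ⟨t, ht, hd⟩ := h.exists_dist_le hγ hx hy
  refine ⟨γ t, ?_, hd.trans hR⟩
  rw [hγ.dist_eq le_rfl ht.1 ht.2, hγ.dist_eq ht.1 ht.2 le_rfl, hγ.dist_eq le_rfl hγ.1 le_rfl]
  ring

lemma compl_plus (h : Curtain S) : h.plusᶜ = h.minus ∪ h.carrier := by
  rw [compl_eq_comm]
  exact IsCompl.compl_eq ⟨Disjoint.union_left h.disjoint_minus_plus h.disjoint_carrier_plus,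
    codisjoint_iff.2 h.union_eq_univ⟩

lemma compl_minus (h : Curtain S) : h.minusᶜ = h.carrier ∪ h.plus :=
  IsCompl.compl_eq ⟨Disjoint.union_right h.disjoint_minus_carrier h.disjoint_minus_plus,
    codisjoint_iff.2 ((union_assoc _ _ _).symm.trans h.union_eq_univ)⟩

/-- A connected set disjoint from a curtain lies on one side of it. -/
lemma subset_minus_or_subset_plus (h : Curtain S) {U : Set S} (hU : IsPreconnected U)
    (hd : Disjoint U h.carrier) : U ⊆ h.minus ∨ U ⊆ h.plus := by
  have hD := h.one_le_D
  have hsub : ∀ x ∈ U, x ∈ h.minus ∨ x ∈ h.plus := by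
    intro x hx
    have := h.union_eq_univ.symm ▸ mem_univ x
    rcases this with (hm | hc) | hp
    · exact Or.inl hm
    · exact absurd hc (disjoint_left.1 hd hx)
    · exact Or.inr hp
  -- The halfspaces need not be open. They are more than `3 * D ≥ 3` apart, so their open
  -- 1-neighbourhoods are disjoint and serve instead.
  have key := hU.subset_or_subset (u := Metric.thickening 1 h.minus)
    (v := Metric.thickening 1 h.plus) Metric.isOpen_thickening Metric.isOpen_thickening
    (by
      rw [disjoint_left]
      intro z hz hz'
      obtain ⟨x, hx, hzx⟩ := Metric.mem_thickening_iff.1 hz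
      obtain ⟨y, hy, hzy⟩ := Metric.mem_thickening_iff.1 hz'
      linarith [h.lt_dist hx hy, dist_triangle_left x y z])
    (fun x hx => (hsub x hx).imp (fun e => Metric.self_subset_thickening one_pos _ e)
      (fun e => Metric.self_subset_thickening one_pos _ e))
  refine key.imp (fun k x hx => (hsub x hx).resolve_right fun hp => ?_)
    (fun k x hx => (hsub x hx).resolve_left fun hm => ?_)
  · obtain ⟨y, hy, hxy⟩ := Metric.mem_thickening_iff.1 (k hx)
    rw [dist_comm] at hxy
    linarith [h.lt_dist hy hp]
  · obtain ⟨y, hy, hxy⟩ := Metric.mem_thickening_iff.1 (k hx)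
    linarith [h.lt_dist hm hy]

/-- The set of points projecting to a subgeodesic of the pole is connected. -/
lemma isPreconnected_of_interval (hS : IsGeodesicSpace S) (h : Curtain S) {b c : ℝ} (hb : 0 ≤ b)
    (hbc : b ≤ c) (hc : c ≤ 20 * h.D) :
    IsPreconnected {x | closestPoints h.geod x ⊆ h.path '' Icc b c} := by
  have hmem : h.path '' Icc b c ⊆ {x | closestPoints h.geod x ⊆ h.path '' Icc b c} := by
    intro x hx p hp
    rw [eq_of_mem_closestPoints (image_mono (Icc_subset_Icc hb hc) hx) hp]
    exact hx
  have hpre : IsPreconnected (h.path '' Icc b c) :=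
    isPreconnected_Icc.image _ (h.isGeodesic.continuousOn.mono (Icc_subset_Icc hb hc))
  refine isPreconnected_of_forall (h.path b) fun y hy => ?_
  obtain ⟨p, hp⟩ := h.closestPoints_nonempty y
  obtain ⟨γ, ℓ, hγ, rfl, rfl⟩ := hS y p
  refine ⟨h.path '' Icc b c ∪ γ '' Icc 0 ℓ, union_subset hmem ?_, Or.inl ⟨b, ⟨le_rfl, hbc⟩, rfl⟩,
    Or.inr ⟨0, ⟨le_rfl, hγ.1⟩, rfl⟩, ?_⟩
  · rintro _ ⟨t, ht, rfl⟩
    refine (closestPoints_subset_of_between hp ?_).trans hy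
    rw [hγ.dist_eq le_rfl ht.1 ht.2, hγ.dist_eq ht.1 ht.2 le_rfl, hγ.dist_eq le_rfl hγ.1 le_rfl]
    ring
  · exact hpre.union _ (hy hp) ⟨ℓ, ⟨hγ.1, le_rfl⟩, rfl⟩
      (isPreconnected_Icc.image _ hγ.continuousOn)

lemma isPreconnected_carrier (hS : IsGeodesicSpace S) (h : Curtain S) :
    IsPreconnected h.carrier := by
  have := h.D_pos
  exact h.isPreconnected_of_interval hS h.a_pos.le (by linarith) h.a_lt.le

lemma isPreconnected_compl_minus (hS : IsGeodesicSpace S) (h : Curtain S) :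
    IsPreconnected h.minusᶜ := by
  have hD := h.D_pos
  have ha := h.a_lt
  have ha' := h.a_pos
  convert h.isPreconnected_of_interval hS ha'.le (by linarith : h.a ≤ 20 * h.D) le_rfl using 1
  ext x
  constructor
  · intro hx p hp
    obtain ⟨t, ht, rfl⟩ := hp.1
    refine ⟨t, ⟨?_, ht.2⟩, rfl⟩
    by_contra! hlt
    exact hx ⟨_, hp, t, ⟨ht.1, hlt⟩, rfl⟩
  · rintro hx ⟨p, hp, t, ht, rfl⟩
    obtain ⟨u, hu, e⟩ := hx hp
    have := h.path_inj ⟨ha'.le.trans hu.1, hu.2⟩ ⟨ht.1, by linarith [ht.2]⟩ e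
    linarith [hu.1, ht.2]

lemma isPreconnected_compl_plus (hS : IsGeodesicSpace S) (h : Curtain S) :
    IsPreconnected h.plusᶜ := by
  have hD := h.D_pos
  have ha := h.a_lt
  have ha' := h.a_pos
  convert h.isPreconnected_of_interval hS le_rfl (by linarith : 0 ≤ h.a + 10 * h.D) ha.le using 1
  ext x
  constructor
  · intro hx p hp
    obtain ⟨t, ht, rfl⟩ := hp.1
    refine ⟨t, ⟨ht.1, ?_⟩, rfl⟩
    by_contra! hlt
    exact hx ⟨_, hp, t, ⟨hlt, ht.2⟩, rfl⟩
  · rintro hx ⟨p, hp, t, ht, rfl⟩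
    obtain ⟨u, hu, e⟩ := hx hp
    have := h.path_inj ⟨hu.1, hu.2.trans ha.le⟩ ⟨by linarith [ht.1], ht.2⟩ e
    linarith [hu.2, ht.1]

/-- The curtain `h` and its minus side lie in the minus side of `k`. -/
def Before (h k : Curtain S) : Prop := h.plusᶜ ⊆ k.minus

/-! ### Nested curtains. -/

section Before

variable {h k l : Curtain S}

lemma Before.minus (H : Before h k) {x : S} (hx : x ∉ h.plus) : x ∈ k.minus := H hx

lemma Before.plus (H : Before h k) {x : S} (hx : x ∉ k.minus) : x ∈ h.plus := by
  by_contra hx'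
  exact hx (H hx')

lemma notMem_plus_of_mem_minus {x : S} (hx : x ∈ h.minus) : x ∉ h.plus :=
  disjoint_left.1 h.disjoint_minus_plus hx

lemma notMem_minus_of_mem_plus {x : S} (hx : x ∈ h.plus) : x ∉ h.minus :=
  disjoint_right.1 h.disjoint_minus_plus hx

lemma notMem_plus_of_mem_carrier {x : S} (hx : x ∈ h.carrier) : x ∉ h.plus :=
  disjoint_left.1 h.disjoint_carrier_plus hx

lemma notMem_minus_of_mem_carrier {x : S} (hx : x ∈ h.carrier) : x ∉ h.minus :=
  disjoint_right.1 h.disjoint_minus_carrier hx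

lemma Before.trans (H : Before h k) (H' : Before k l) : Before h l :=
  fun _ hx => H'.minus (notMem_plus_of_mem_minus (H.minus hx))

lemma Before.plus_ssubset (H : Before h k) : k.plus ⊂ h.plus := by
  refine ⟨fun x hx => H.plus (notMem_minus_of_mem_plus hx), fun hsub => ?_⟩
  have hk := k.path_a_mem_carrier
  exact notMem_plus_of_mem_carrier hk (hsub (H.plus (notMem_minus_of_mem_carrier hk)))

lemma Before.map (H : Before h k) (g : S ≃ᵢ S) : Before (h.map g) (k.map g) := by
  unfold Before at *
  rw [map_plus, map_minus, ← image_compl_eq g.bijective]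
  exact image_mono H

/-- A constant geodesic at a point of `h.minus ∩ k.plus` would have to meet the separating ball,
which lies in `h.plus`; so this intersection is empty. The rest is connectedness: a curtain, or the
complement of a halfspace, lies on one side of any curtain disjoint from it, and the centre of the
ball decides which. -/
lemma BallSeparated.before (hS : IsGeodesicSpace S) {R : ℕ} (H : BallSeparated R h k) :
    Before h k := by
  obtain ⟨hd, b, r, hr, -, hB, hγ⟩ := H
  have hb := hB (Metric.mem_closedBall_self hr)
  have hdisj : ∀ x ∈ h.minus, x ∉ k.plus := by
    intro x hx hx'
    obtain ⟨t, -, ht⟩ := hγ (fun _ => x) 0 ⟨le_rfl, fun t ht u hu => by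
      rw [le_antisymm ht.2 ht.1, le_antisymm hu.2 hu.1]; simp⟩ hx hx'
    exact notMem_plus_of_mem_minus hx (hB ht).1
  have hkc : ¬ h.carrier ⊆ k.plus ∧ ¬ k.carrier ⊆ h.minus := by
    constructor
    · intro hh
      have h1 : Disjoint k.plusᶜ h.carrier := (disjoint_compl_left).mono_right hh
      rcases h.subset_minus_or_subset_plus (k.isPreconnected_compl_plus hS) h1 with h2 | h2
      · exact notMem_minus_of_mem_plus hb.1 (h2 (notMem_plus_of_mem_minus hb.2))
      · obtain ⟨x, hx⟩ := h.minus_nonempty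
        exact hdisj x hx (by
          by_contra hx'
          exact notMem_plus_of_mem_minus hx (h2 hx'))
    · intro hh
      have h1 : Disjoint h.minusᶜ k.carrier := (disjoint_compl_left).mono_right hh
      rcases k.subset_minus_or_subset_plus (h.isPreconnected_compl_minus hS) h1 with h2 | h2
      · obtain ⟨x, hx⟩ := k.plus_nonempty
        exact hdisj x (by
          by_contra hx'
          exact notMem_minus_of_mem_plus hx (h2 hx')) hx
      · exact notMem_plus_of_mem_minus hb.2 (h2 (notMem_minus_of_mem_plus hb.1))
  have h1 := (k.subset_minus_or_subset_plus (h.isPreconnected_carrier hS) hd).resolve_right hkc.1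
  have h2 : Disjoint k.minusᶜ h.carrier := (disjoint_compl_left).mono_right h1
  have h3 := (h.subset_minus_or_subset_plus (k.isPreconnected_carrier hS) hd.symm).resolve_left
    hkc.2
  have h4 : k.minusᶜ ⊆ h.plus := by
    refine (h.subset_minus_or_subset_plus (k.isPreconnected_compl_minus hS) h2).resolve_left
      fun hm => ?_
    have hk := k.path_a_mem_carrier
    exact notMem_plus_of_mem_minus (hm (notMem_minus_of_mem_carrier hk)) (h3 hk)
  exact compl_subset_comm.1 h4

lemma BallSeparated.map {R : ℕ} (H : BallSeparated R h k) (g : S ≃ᵢ S) :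
    BallSeparated R (h.map g) (k.map g) := by
  obtain ⟨hd, b, r, hr, hrR, hB, hγ⟩ := H
  refine ⟨?_, g b, r, hr, hrR, ?_, ?_⟩
  · rw [map_carrier, map_carrier]
    exact (disjoint_image_iff g.injective).2 hd
  · rw [map_plus, map_minus, ← image_inter g.injective, ← g.image_closedBall]
    exact image_mono hB
  · intro γ ℓ hγ' h0 hℓ
    rw [map_minus] at h0
    rw [map_plus] at hℓ
    obtain ⟨x, hx, e0⟩ := h0
    obtain ⟨y, hy, e1⟩ := hℓ
    obtain ⟨t, ht, htb⟩ := hγ (g.symm ∘ γ) ℓ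
      ⟨hγ'.1, fun t ht u hu => by
        simpa only [Function.comp_apply, g.symm.dist_eq] using hγ'.2 t ht u hu⟩
      (by simpa [← e0] using hx) (by simpa [← e1] using hy)
    refine ⟨t, ht, ?_⟩
    rw [Metric.mem_closedBall, ← g.symm.dist_eq, g.symm_apply_apply]
    exact htb

/-- Distinct curtains of an `R`-chain induce distinct walls, so the cardinality of the set of walls
counts the curtains. The centre of the ball, in `h.plus ∩ k.minus`, rules out equality with matching
orientation; nesting rules out the opposite one. -/
lemma BallSeparated.wall_ne (hS : IsGeodesicSpace S) {R : ℕ} (H : BallSeparated R h k)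
    {v w : Sym2 (Set S)} (hv : v ∈ h.walls) (hw : w ∈ k.walls) : v ≠ w := by
  have side : ∀ (l : Curtain S), ∀ u ∈ l.walls, ∃ A, u = s(A, Aᶜ) ∧ l.minus ⊆ A ∧
      A ⊆ l.plusᶜ := by
    intro l u hu
    rcases hu with rfl | rfl
    · refine ⟨l.plusᶜ, ?_, ?_, subset_rfl⟩
      · rw [compl_compl, compl_plus]
      · exact subset_compl_iff_disjoint_right.2 l.disjoint_minus_plus
    · refine ⟨l.minus, ?_, subset_rfl, ?_⟩
      · rw [compl_minus]
      · exact subset_compl_iff_disjoint_right.2 l.disjoint_minus_plus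
  obtain ⟨A, rfl, hA, hA'⟩ := side h v hv
  obtain ⟨B, rfl, hB, hB'⟩ := side k w hw
  have hb := H.before hS
  obtain ⟨-, b, r, hr, -, hball, -⟩ := H
  have hbb := hball (Metric.mem_closedBall_self hr)
  intro e
  rcases Sym2.eq_iff.1 e with ⟨rfl, -⟩ | ⟨rfl, -⟩
  · exact hA' (hB hbb.2) hbb.1
  · obtain ⟨x, hx⟩ := h.minus_nonempty
    exact hA hx (hB (hb (hA' (hA hx))))

end Before

/-- A point pair separated by a chain of curtains is as distant as the chain is thick. -/
lemma sum_le_dist (hS : IsGeodesicSpace S) (m : ℕ) : ∀ (h : ℕ → Curtain S) (x y : S),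
    (∀ i j, i < j → j < m → Before (h i) (h j)) → (∀ i < m, x ∈ (h i).minus) →
      (∀ i < m, y ∈ (h i).plus) → ∑ i ∈ Finset.range m, 2 * (h i).D ≤ dist x y := by
  induction m with
  | zero => intros; simp
  | succ m ih =>
    intro h x y hb hx hy
    obtain ⟨γ, ℓ, hγ, rfl, rfl⟩ := hS x y
    -- Reaching `γ u` costs more than `3 * D` for the first curtain, and `γ t` is still before all
    -- the others. The two stretches overlap in at most `1 ≤ D`, which is why only `2 * D` per
    -- curtain is claimed.
    obtain ⟨t, u, h0, htu, huℓ, hu1, ht, hu⟩ := exists_transition (P := fun t => γ t ∉ (h 0).plus)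
      hγ.1 (notMem_plus_of_mem_minus (hx 0 (by omega))) (not_not.2 (hy 0 (by omega)))
    have e1 := (h 0).lt_dist (hx 0 (by omega)) (not_not.1 hu)
    have e2 := ih (fun i => h (i + 1)) (γ t) (γ ℓ) (fun i j hij hj => hb _ _ (by omega) (by omega))
      (fun i hi => (hb 0 (i + 1) (by omega) (by omega)).minus ht) (fun i hi => hy _ (by omega))
    have := (h 0).one_le_D
    rw [Finset.sum_range_succ']
    rw [hγ.dist_eq h0 (htu.trans huℓ) le_rfl] at e2
    rw [hγ.dist_eq le_rfl (h0.trans htu) huℓ] at e1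
    rw [hγ.dist_eq le_rfl hγ.1 le_rfl]
    linarith

/-- Distant members of a chain of curtains of the same thickness are ball-separated. -/
lemma ballSeparated_of_chain (hS : IsGeodesicSpace S) (h : ℕ → Curtain S) {D : ℝ}
    (hD : ∀ i, (h i).D = D) (hb : ∀ i j, i < j → Before (h i) (h j)) :
    BallSeparated ⌈24 * D⌉₊ (h 0) (h 28) := by
  have hDpos : 0 < D := hD 0 ▸ (h 0).D_pos
  -- Thirteen curtains on either side of `h 14` keep its bottleneck ball, of radius `24 * D < 26 *
  -- D`, away from `h 0` and `h 28`.
  have hsum : ∀ j, ∑ i ∈ Finset.range 13, 2 * (h (i + j)).D = 26 * D := fun j => by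
    simp only [hD, Finset.sum_const, Finset.card_range, nsmul_eq_mul]
    push_cast
    ring
  have hc := (h 14).path_a_mem_carrier
  refine ⟨?_, (h 14).path (h 14).a, 24 * D, by linarith, Nat.le_ceil _, ?_, ?_⟩
  · rw [disjoint_left]
    exact fun x hx hx' => notMem_minus_of_mem_carrier hx'
      ((hb 0 28 (by norm_num)).minus (notMem_plus_of_mem_carrier hx))
  · intro y hy
    rw [Metric.mem_closedBall] at hy
    constructor
    · by_contra hy'
      have := sum_le_dist hS 13 (fun i => h (i + 1)) y ((h 14).path (h 14).a)
        (fun i j hij _ => hb _ _ (by omega)) (fun i _ => (hb 0 (i + 1) (by omega)).minus hy')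
        (fun i hi => (hb (i + 1) 14 (by omega)).plus (notMem_minus_of_mem_carrier hc))
      rw [hsum] at this
      linarith
    · by_contra hy'
      have := sum_le_dist hS 13 (fun i => h (i + 15)) ((h 14).path (h 14).a) y
        (fun i j hij _ => hb _ _ (by omega))
        (fun i hi => (hb 14 (i + 15) (by omega)).minus (notMem_plus_of_mem_carrier hc))
        (fun i hi => (hb (i + 15) 28 (by omega)).plus hy')
      rw [hsum, dist_comm] at this
      linarith
  · intro γ ℓ hγ h0 hℓ
    obtain ⟨t, ht, hd⟩ := (h 14).exists_dist_le hγ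
      ((hb 0 14 (by norm_num)).minus (notMem_plus_of_mem_minus h0))
      ((hb 14 28 (by norm_num)).plus (notMem_minus_of_mem_plus hℓ))
    exact ⟨t, ht, by rw [Metric.mem_closedBall, ← hD 14]; exact hd⟩

end Curtain

/-! ### The chain distances `d_R`, and their comparison with the metric of `S`. -/

section ChainDist

variable {S : Type*} [MetricSpace S] {R : ℕ} {x y z : WallUltrafilter (curtainWalls S)}

open Curtain

lemma exists_mem_chainSystem_of_le {M : ℕ} (h : (M : ℕ∞) ≤ chainDist R x y) (hM : M ≠ 0) :
    ∃ c ∈ chainSystem S R, (∀ w ∈ c, x.side w ≠ y.side w) ∧ (M : ℕ∞) ≤ c.encard := by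
  obtain ⟨n, rfl⟩ := Nat.exists_eq_succ_of_ne_zero hM
  have h1 : (n : ℕ∞) < chainDist R x y :=
    lt_of_lt_of_le (by exact_mod_cast n.lt_succ_self) h
  unfold chainDist at h1
  obtain ⟨c, hc⟩ := lt_iSup_iff.1 h1
  obtain ⟨hc1, hc2⟩ := lt_iSup_iff.1 hc
  refine ⟨c, hc1.1, hc1.2, ?_⟩
  rw [Nat.succ_eq_add_one, Nat.cast_add, Nat.cast_one]
  exact Order.add_one_le_of_lt hc2

/-- Lower bounds on the chain distance are witnessed by finite chains of ball-separated curtains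
inducing walls that separate the two ultrafilters. -/
lemma le_chainDist_iff (hS : IsGeodesicSpace S) {M : ℕ} :
    (M : ℕ∞) ≤ chainDist R x y ↔ ∃ (h : Fin M → Curtain S) (w : Fin M → curtainWalls S),
      (∀ i j, i < j → BallSeparated R (h i) (h j)) ∧
      (∀ i, (w i : Sym2 (Set S)) ∈ (h i).walls) ∧ ∀ i, x.side (w i) ≠ y.side (w i) := by
  classical
  constructor
  · intro hle
    rcases eq_or_ne M 0 with rfl | hM
    · exact ⟨Fin.elim0, Fin.elim0, fun i => i.elim0, fun i => i.elim0, fun i => i.elim0⟩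
    obtain ⟨c, ⟨I, h, w, -, hR, hw, rfl⟩, hsep, hcard⟩ := exists_mem_chainSystem_of_le hle hM
    obtain ⟨T, hT, hTc⟩ := Set.exists_subset_encard_eq hcard
    have hTf : T.Finite := Set.finite_of_encard_eq_coe hTc
    have : Nonempty I := by
      rw [← range_nonempty_iff_nonempty (f := w), ← encard_ne_zero]
      exact (lt_of_lt_of_le (by exact_mod_cast Nat.pos_of_ne_zero hM) hcard).ne'
    choose! f hf using hT
    have hinj : InjOn f T := fun a ha b hb e => by rw [← hf ha, ← hf hb, e]
    have hcard' : (hTf.toFinset.image f).card = M := by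
      rw [Finset.card_image_of_injOn (by simpa using hinj)]
      have := hTf.encard_eq_coe_toFinset_card
      rw [hTc] at this
      exact_mod_cast this.symm
    let e := (hTf.toFinset.image f).orderEmbOfFin hcard'
    exact ⟨fun i => h (e i), fun i => w (e i), fun i j hij => hR.2 _ _ (e.strictMono hij),
      fun i => hw _, fun i => hsep _ ⟨_, rfl⟩⟩
  · rintro ⟨h, w, hb, hw, hsep⟩
    let e : Ico (0 : ℤ) M → Fin M := fun i => ⟨(i : ℤ).toNat, by
      have := i.2.1; have := i.2.2; omega⟩
    have he : ∀ i j, i < j → e i < e j := by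
      intro i j hij
      have := i.2.1
      have : (i : ℤ) < j := hij
      rw [Fin.lt_def]
      change (i : ℤ).toNat < (j : ℤ).toNat
      omega
    have hmem : range (fun i => w (e i)) ∈ {c | c ∈ chainSystem S R ∧
        ∀ h ∈ c, x.side h ≠ y.side h} := by
      refine ⟨⟨Ico 0 M, fun i => h (e i), fun i => w (e i), ordConnected_Ico, ⟨?_, ?_⟩,
        fun i => hw _, rfl⟩, ?_⟩
      · intro i j k hij hjk
        have h1 := (hb _ _ (he i j (Subtype.coe_lt_coe.1 (by omega)))).before hS
        have h2 := (hb _ _ (he j k (Subtype.coe_lt_coe.1 (by omega)))).before hS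
        exact ⟨fun s hs => h1.minus (notMem_plus_of_mem_carrier hs),
          fun s hs => h2.plus (notMem_minus_of_mem_carrier hs)⟩
      · exact fun i j hij => hb _ _ (he i j hij)
      · rintro _ ⟨i, rfl⟩
        exact hsep _
    have hinj : Function.Injective w := by
      intro i j hij
      by_contra hne
      rcases lt_or_gt_of_ne hne with hlt | hlt
      · exact (hb i j hlt).wall_ne hS (hw i) (hw j) (congrArg _ hij)
      · exact (hb j i hlt).wall_ne hS (hw j) (hw i) (congrArg _ hij.symm)
    have hsub : range w ⊆ range fun i => w (e i) := by
      rintro _ ⟨i, rfl⟩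
      refine ⟨⟨(i : ℕ), by simp⟩, congrArg w (Fin.ext ?_)⟩
      simp [e]
    have hcard : (range w).encard = M := by
      rw [← image_univ, hinj.encard_image, encard_univ]
      simp
    calc (M : ℕ∞) = (range w).encard := hcard.symm
      _ ≤ _ := Set.encard_le_encard hsub
      _ ≤ _ := le_iSup₂ (f := fun c (_ : c ∈ {c | c ∈ chainSystem S R ∧
        ∀ h ∈ c, x.side h ≠ y.side h}) => c.encard) _ hmem

lemma chainDist_comm (R : ℕ) (x y : WallUltrafilter (curtainWalls S)) :
    chainDist R x y = chainDist R y x := by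
  simp only [chainDist, ne_comm]

lemma le_of_forall_natCast_le {a b : ℕ∞} (h : ∀ n : ℕ, (n : ℕ∞) ≤ a → (n : ℕ∞) ≤ b) : a ≤ b :=
  ENat.forall_natCast_le_iff_le.1 h

lemma card_le_chainDist (hS : IsGeodesicSpace S) {M : ℕ} {h : Fin M → Curtain S}
    {w : Fin M → curtainWalls S} (hb : ∀ i j, i < j → BallSeparated R (h i) (h j))
    (hw : ∀ i, (w i : Sym2 (Set S)) ∈ (h i).walls) (T : Finset (Fin M))
    (hT : ∀ i ∈ T, x.side (w i) ≠ y.side (w i)) : (T.card : ℕ∞) ≤ chainDist R x y := by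
  refine (le_chainDist_iff hS).2 ⟨fun i => h (T.orderEmbOfFin rfl i),
    fun i => w (T.orderEmbOfFin rfl i), fun i j hij => hb _ _ ((T.orderEmbOfFin rfl).strictMono hij),
    fun i => hw _, fun i => hT _ (T.orderEmbOfFin_mem rfl i)⟩

/-- A wall separating `x` from `z` separates `y` from one of them. Ball-separation is required of
all pairs of a chain, so the two subfamilies are again chains. -/
lemma chainDist_triangle (hS : IsGeodesicSpace S) (R : ℕ)
    (x y z : WallUltrafilter (curtainWalls S)) :
    chainDist R x z ≤ chainDist R x y + chainDist R y z := by
  classical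
  refine le_of_forall_natCast_le fun M hM => ?_
  obtain ⟨h, w, hb, hw, hsep⟩ := (le_chainDist_iff hS).1 hM
  have h1 := card_le_chainDist hS (x := x) (y := y) hb hw
    (Finset.univ.filter fun i => x.side (w i) ≠ y.side (w i)) (by simp)
  have h2 := card_le_chainDist hS (x := y) (y := z) hb hw
    (Finset.univ.filter fun i => ¬ x.side (w i) ≠ y.side (w i)) (by
      intro i hi e
      simp only [Finset.mem_filter, not_not] at hi
      exact hsep i (hi.2.trans e))
  refine le_trans ?_ (add_le_add h1 h2)
  have := Finset.card_filter_add_card_filter_not (s := (Finset.univ : Finset (Fin M)))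
    fun i => x.side (w i) ≠ y.side (w i)
  rw [Finset.card_univ, Fintype.card_fin] at this
  exact_mod_cast this.ge

lemma mapWall_mem_walls (g : S ≃ᵢ S) {h : Curtain S} {w : curtainWalls S}
    (hw : (w : Sym2 (Set S)) ∈ h.walls) : (mapWall g w : Sym2 (Set S)) ∈ (h.map g).walls := by
  unfold Curtain.walls
  rw [h.map_minus, h.map_plus, h.map_carrier, ← image_union, ← image_union]
  change Sym2.map _ (w : Sym2 (Set S)) ∈ _
  rcases hw with e | e <;> rw [e]
  · exact Or.inl rfl
  · exact Or.inr rfl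

lemma chainDist_map_le (hS : IsGeodesicSpace S) (R : ℕ) (x y : WallUltrafilter (curtainWalls S))
    (g : S ≃ᵢ S) : chainDist R (x.map g) (y.map g) ≤ chainDist R x y := by
  refine le_of_forall_natCast_le fun M hM => ?_
  obtain ⟨h, w, hb, hw, hsep⟩ := (le_chainDist_iff hS).1 hM
  exact (le_chainDist_iff hS).2 ⟨fun i => (h i).map g⁻¹, fun i => mapWall g⁻¹ (w i),
    fun i j hij => (hb i j hij).map _, fun i => mapWall_mem_walls _ (hw i),
    fun i e => hsep i (congrArg (g '' ·) e)⟩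

lemma principal_map (s : S) (g : S ≃ᵢ S) : (principal s).map g = principal (g s) := by
  ext1
  funext h
  refine (curtainWalls_existsUnique (g s) h).unique
    ⟨((principal s).map g).side_mem h, ?_⟩ ⟨(principal (g s)).side_mem h, mem_principal_side _ _⟩
  exact ⟨s, mem_principal_side _ _, rfl⟩

/-- Either side of a wall may contain the curtain itself, so separation by the wall only excludes
the wrong halfspace for each point. -/
lemma principal_side_ne {s t : S} {h : Curtain S} {w : curtainWalls S}
    (hw : (w : Sym2 (Set S)) ∈ h.walls) (hne : (principal s).side w ≠ (principal t).side w) :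
    (s ∉ h.plus ∧ t ∉ h.minus) ∨ (t ∉ h.plus ∧ s ∉ h.minus) := by
  have hs := mem_principal_side s w
  have ht := mem_principal_side t w
  have hs' := (principal s).side_mem w
  have ht' := (principal t).side_mem w
  rcases hw with e | e <;> rw [e] at hs' ht' <;>
    rcases Sym2.mem_iff.1 hs' with a | a <;> rcases Sym2.mem_iff.1 ht' with b | b <;>
    rw [a] at hs hne <;> rw [b] at ht hne <;> try exact absurd rfl hne
  · rw [← compl_plus] at hs
    exact Or.inl ⟨hs, notMem_minus_of_mem_plus ht⟩
  · rw [← compl_plus] at ht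
    exact Or.inr ⟨ht, notMem_minus_of_mem_plus hs⟩
  · rw [← compl_minus] at ht
    exact Or.inl ⟨notMem_plus_of_mem_minus hs, ht⟩
  · rw [← compl_minus] at hs
    exact Or.inr ⟨notMem_plus_of_mem_minus ht, hs⟩

/-- The extremal curtains may contain `s` or `t`, and the first one decides which of the two points
comes first. Discarding both extremal curtains, nesting puts `s` and `t` strictly on opposite sides
of all the others. -/
lemma exists_chain_of_le (hS : IsGeodesicSpace S) {m : ℕ} {s t : S}
    (hle : ((m + 2 : ℕ) : ℕ∞) ≤ chainDist R (principal s) (principal t)) :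
    ∃ h : ℕ → Curtain S, (∀ i j, i < j → j < m → Before (h i) (h j)) ∧
      ((∀ i < m, s ∈ (h i).minus ∧ t ∈ (h i).plus) ∨
        ∀ i < m, t ∈ (h i).minus ∧ s ∈ (h i).plus) := by
  obtain ⟨h, w, hb, hw, hsep⟩ := (le_chainDist_iff hS).1 hle
  have hb' : ∀ i j, i < j → Before (h i) (h j) := fun i j hij => (hb i j hij).before hS
  have key : ∀ s t : S, (s ∉ (h 0).plus ∧ t ∉ (h 0).minus) →
      (∀ i, (s ∉ (h i).plus ∧ t ∉ (h i).minus) ∨ (t ∉ (h i).plus ∧ s ∉ (h i).minus)) →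
      ∀ i : Fin (m + 2), 0 < (i : ℕ) → (i : ℕ) < m + 1 →
        s ∈ (h i).minus ∧ t ∈ (h i).plus := by
    intro s t h0 hor i hi hi'
    have h1 : ∀ j : Fin (m + 2), 0 < (j : ℕ) → s ∈ (h j).minus := fun j hj =>
      (hb' 0 j (Fin.lt_def.2 hj)).minus h0.1
    refine ⟨h1 i hi, ?_⟩
    have hl := (hor (Fin.last _)).resolve_right fun hc =>
      hc.2 (h1 _ (by simp))
    exact (hb' i (Fin.last _) (Fin.lt_def.2 (by simpa using hi'))).plus hl.2
  -- The shift drops the first curtain; the minimum only makes the family total and is inactive for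
  -- `i < m`.
  refine ⟨fun i => h ⟨min (i + 1) (m + 1), by omega⟩, fun i j hij hj => hb' _ _ (Fin.lt_def.2 (by
    simp only; omega)), ?_⟩
  rcases principal_side_ne (hw 0) (hsep 0) with h0 | h0
  · exact Or.inl fun i hi => key s t h0 (fun i => principal_side_ne (hw i) (hsep i)) _
      (by simp only; omega) (by simp only; omega)
  · exact Or.inr fun i hi => key t s h0 (fun i => (principal_side_ne (hw i) (hsep i)).symm) _
      (by simp only; omega) (by simp only; omega)

lemma natCast_le_of_le_chainDist (hS : IsGeodesicSpace S) {M : ℕ} {s t : S}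
    (hle : (M : ℕ∞) ≤ chainDist R (principal s) (principal t)) : (M : ℝ) ≤ dist s t + 2 := by
  rcases lt_or_ge M 2 with hM | hM
  · have : (M : ℝ) ≤ 2 := by exact_mod_cast hM.le
    linarith [dist_nonneg (x := s) (y := t)]
  obtain ⟨m, rfl⟩ := Nat.exists_eq_add_of_le' hM
  obtain ⟨h, hb, hor⟩ := exists_chain_of_le hS hle
  have hsum : (m : ℝ) ≤ ∑ i ∈ Finset.range m, 2 * (h i).D := by
    calc (m : ℝ) = ∑ i ∈ Finset.range m, (1 : ℝ) := by simp
      _ ≤ _ := Finset.sum_le_sum fun i _ => by linarith [(h i).one_le_D]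
  push_cast
  rcases hor with hor | hor
  · linarith [sum_le_dist hS m h s t hb (fun i hi => (hor i hi).1) fun i hi => (hor i hi).2]
  · linarith [sum_le_dist hS m h t s hb (fun i hi => (hor i hi).1) fun i hi => (hor i hi).2,
      dist_comm s t]

lemma chainDist_principal_le (hS : IsGeodesicSpace S) (R : ℕ) (s t : S) :
    (chainDist R (principal s) (principal t) : ℝ≥0∞) ≤ ENNReal.ofReal (dist s t + 2) := by
  have h1 : chainDist R (principal s) (principal t) ≤ (⌊dist s t + 2⌋₊ : ℕ) :=
    le_of_forall_natCast_le fun M hM => by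
      exact_mod_cast Nat.le_floor (natCast_le_of_le_chainDist hS hM)
  calc (chainDist R (principal s) (principal t) : ℝ≥0∞)
      ≤ ((⌊dist s t + 2⌋₊ : ℕ) : ℕ∞) := ENat.toENNReal_le.2 h1
    _ = ((⌊dist s t + 2⌋₊ : ℕ) : ℝ≥0∞) := by simp
    _ = ENNReal.ofReal (⌊dist s t + 2⌋₊ : ℝ) := by simp
    _ ≤ _ := ENNReal.ofReal_le_ofReal (Nat.floor_le (by positivity))

/-- Chains of walls separating two principal ultrafilters. -/
lemma le_chainDist_principal (hS : IsGeodesicSpace S) {M : ℕ} {s t : S} (h : Fin M → Curtain S)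
    (hb : ∀ i j, i < j → BallSeparated R (h i) (h j)) (hs : ∀ i, s ∈ (h i).minus)
    (ht : ∀ i, t ∈ (h i).plus) : (M : ℕ∞) ≤ chainDist R (principal s) (principal t) := by
  obtain ⟨w, hw⟩ : ∃ w : Fin M → curtainWalls S,
      ∀ i, (w i : Sym2 (Set S)) = s((h i).minus, (h i).carrier ∪ (h i).plus) :=
    ⟨fun i => ⟨_, mem_iUnion.2 ⟨h i, Or.inr rfl⟩⟩, fun i => rfl⟩
  refine (le_chainDist_iff hS).2 ⟨h, w, hb, fun i => Or.inr (hw i), fun i e => ?_⟩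
  have h1 := mem_principal_side s (w i)
  have h2 := mem_principal_side t (w i)
  rw [← e] at h2
  have h3 := (principal s).side_mem (w i)
  rw [hw i] at h3
  rcases Sym2.mem_iff.1 h3 with a | a
  · rw [a] at h2
    exact notMem_minus_of_mem_plus (ht i) h2
  · rw [a, ← compl_minus] at h1
    exact h1 (hs i)

/-! ### The weighted distance. -/

section Graded

variable {lam : ℕ+ → ℝ}

lemma gradedDist_comm (lam : ℕ+ → ℝ) (x y : WallUltrafilter (curtainWalls S)) :
    gradedDist lam x y = gradedDist lam y x := by
  simp only [gradedDist, chainDist_comm _ x y]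

lemma gradedDist_triangle (hS : IsGeodesicSpace S) (lam : ℕ+ → ℝ)
    (x y z : WallUltrafilter (curtainWalls S)) :
    gradedDist lam x z ≤ gradedDist lam x y + gradedDist lam y z := by
  unfold gradedDist
  rw [← ENNReal.tsum_add]
  refine ENNReal.tsum_le_tsum fun R => ?_
  rw [← mul_add, ← ENat.toENNReal_add]
  gcongr
  exact chainDist_triangle hS _ x y z

lemma gradedDist_map_le (hS : IsGeodesicSpace S) (lam : ℕ+ → ℝ)
    (x y : WallUltrafilter (curtainWalls S)) (g : S ≃ᵢ S) :
    gradedDist lam (x.map g) (y.map g) ≤ gradedDist lam x y :=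
  ENNReal.tsum_le_tsum fun R => by
    gcongr
    exact chainDist_map_le hS _ x y g

lemma gradedDist_le_of_chainDist_le (hpos : ∀ R, 0 < lam R) (hsum : Summable lam) {c : ℝ}
    (h : ∀ R : ℕ+, (chainDist R x y : ℝ≥0∞) ≤ ENNReal.ofReal c) :
    gradedDist lam x y ≤ ENNReal.ofReal ((∑' R, lam R) * c) := by
  rw [ENNReal.ofReal_mul (tsum_nonneg fun R => (hpos R).le),
    ENNReal.ofReal_tsum_of_nonneg (fun R => (hpos R).le) hsum, ← ENNReal.tsum_mul_right]
  exact ENNReal.tsum_le_tsum fun R => by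
    gcongr
    exact h R

lemma gradedDist_principal_le (hS : IsGeodesicSpace S) (hpos : ∀ R, 0 < lam R)
    (hsum : Summable lam) (s t : S) : gradedDist lam (principal s) (principal t) ≤
      ENNReal.ofReal ((∑' R, lam R) * (dist s t + 2)) :=
  gradedDist_le_of_chainDist_le hpos hsum fun R => chainDist_principal_le hS R s t

end Graded

end ChainDist

/-! ### From skewering to loxodromic action. -/

section Skewering

variable {S : Type*} [MetricSpace S]

open Curtain

lemma Curtain.before_map_pow {k : Curtain S} {f : S ≃ᵢ S} (H : Before k (k.map f)) {i j : ℕ}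
    (hij : i < j) : Before (k.map (f ^ i)) (k.map (f ^ j)) := by
  have step : ∀ i : ℕ, Before (k.map (f ^ i)) (k.map (f ^ (i + 1))) := fun i => by
    rw [pow_succ]
    exact H.map (f ^ i)
  induction j, hij using Nat.le_induction with
  | base => exact step i
  | succ j _ ih => exact ih.trans (step j)

lemma Curtain.ballSeparated_map_pow (hS : IsGeodesicSpace S) {k : Curtain S} {f : S ≃ᵢ S}
    (H : Before k (k.map f)) {i j : ℕ} (hij : i + 28 ≤ j) :
    BallSeparated ⌈24 * k.D⌉₊ (k.map (f ^ i)) (k.map (f ^ j)) := by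
  -- The exponents run through `i, ..., i + 27`, then jump to `j, j + 1, ...`, so that `i` and `j`
  -- occupy positions 0 and 28 of one nested sequence.
  have := ballSeparated_of_chain hS
    (fun n => k.map (f ^ (if n < 28 then i + n else j + (n - 28)))) (D := k.D) (fun _ => rfl)
    (fun a b hab => before_map_pow H (by split_ifs <;> omega))
  simpa using this

lemma exists_skewers_of_before (hS : IsGeodesicSpace S) {g : S ≃ᵢ S} {k : Curtain S} {n : ℤ}
    (H : Before k (k.map (g ^ n))) :
    ∃ (R : ℕ) (h k : Curtain S), BallSeparated R h k ∧ Skewers g h k := by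
  have h0 := before_map_pow H (show 0 < 28 by norm_num)
  have h1 := before_map_pow H (show 28 < 29 by norm_num)
  refine ⟨_, _, _, ballSeparated_map_pow hS H (show 0 + 28 ≤ 28 by norm_num), n * 29, ?_,
    h0.plus_ssubset⟩
  rw [← map_plus, pow_zero, zpow_mul]
  exact h1.plus_ssubset

lemma Curtain.Skewers.exists_before (hS : IsGeodesicSpace S) {g : S ≃ᵢ S} {R : ℕ}
    {h k : Curtain S} (hb : BallSeparated R h k) (hk : Skewers g h k) :
    ∃ n : ℤ, Before k (k.map (g ^ n)) := by
  obtain ⟨n, hn, -⟩ := hk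
  refine ⟨n, fun x hx => ?_⟩
  rw [map_minus]
  refine image_mono (hb.before hS) ?_
  rw [image_compl_eq (IsometryEquiv.bijective _)]
  exact fun hx' => hx (hn.1 hx')

/-- Every 28th translate of `k` is used, to have pairwise ball-separation with one common `R`. The
base point lies on `k`, hence before all of these, and its image under `f ^ i` lies on a translate
beyond all of them. -/
lemma natCast_le_chainDist_pow (hS : IsGeodesicSpace S) {k : Curtain S} {f : S ≃ᵢ S}
    (H : Before k (k.map f)) {i M : ℕ} (hM : 28 * M < i) :
    (M : ℕ∞) ≤ chainDist ⌈24 * k.D⌉₊ (principal (k.path k.a))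
      (principal ((f ^ i : S ≃ᵢ S) (k.path k.a))) := by
  refine le_chainDist_principal hS (fun l => k.map (f ^ (28 * ((l : ℕ) + 1))))
    (fun l l' hl => ballSeparated_map_pow hS H ?_) (fun l => ?_) fun l => ?_
  · have : (l : ℕ) < l' := hl
    omega
  · have := before_map_pow H (show 0 < 28 * ((l : ℕ) + 1) by omega)
    exact this.minus (notMem_plus_of_mem_carrier (k.map (f ^ 0)).path_a_mem_carrier)
  · have := l.2
    have := before_map_pow H (show 28 * ((l : ℕ) + 1) < i from by omega)
    exact this.plus (notMem_minus_of_mem_carrier (k.map (f ^ i)).path_a_mem_carrier)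

lemma chainDist_zpow_le (hS : IsGeodesicSpace S) (R : ℕ) (g : S ≃ᵢ S) (s : S) (m n : ℤ) :
    chainDist R (principal s) (principal ((g ^ (n - m) : S ≃ᵢ S) s)) ≤
      chainDist R (principal ((g ^ m : S ≃ᵢ S) s)) (principal ((g ^ n : S ≃ᵢ S) s)) := by
  have h := chainDist_map_le hS R (principal ((g ^ m : S ≃ᵢ S) s))
    (principal ((g ^ n : S ≃ᵢ S) s)) (g ^ (-m))
  rw [principal_map, principal_map, ← IsometryEquiv.mul_apply, ← IsometryEquiv.mul_apply,
    ← zpow_add, ← zpow_add, neg_add_cancel, zpow_zero, show (1 : S ≃ᵢ S) s = s from rfl,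
    neg_add_eq_sub] at h
  exact h

lemma chainDist_zpow_natAbs (hS : IsGeodesicSpace S) (R : ℕ) (g : S ≃ᵢ S) (s : S) (i : ℤ) :
    chainDist R (principal s) (principal ((g ^ i.natAbs : S ≃ᵢ S) s)) ≤
      chainDist R (principal s) (principal ((g ^ i : S ≃ᵢ S) s)) := by
  rcases Int.natAbs_eq i with h | h
  · conv_rhs => rw [h]
    rw [zpow_natCast]
  · have := chainDist_zpow_le hS R g s i 0
    rw [zero_sub, zpow_zero, show (1 : S ≃ᵢ S) s = s from rfl, chainDist_comm R (principal ((g ^ i : S ≃ᵢ S) s))] at this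
    conv_lhs => rw [← zpow_natCast, show ((i.natAbs : ℕ) : ℤ) = -i by omega]
    exact this

lemma ofReal_sub_le_of_le_add {a b : ℝ} {x : ℝ≥0∞} (hb : 0 ≤ b)
    (h : ENNReal.ofReal a ≤ x + ENNReal.ofReal b) : ENNReal.ofReal (a - b) ≤ x := by
  rw [ENNReal.ofReal_sub _ hb]
  exact tsub_le_iff_right.2 h

lemma IsQIEmbeddingWith.dist_le {q : ℝ} {f : ℤ → S} (h : IsQIEmbeddingWith edist q f) (m n : ℤ) :
    dist (f m) (f n) ≤ q * |(m : ℝ) - n| + q := by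
  have := (h.2 m n).2
  have hq := h.1
  rw [edist_dist, ENNReal.ofReal_le_ofReal_iff (by positivity)] at this
  exact this

lemma IsQIEmbeddingWith.le_dist {q : ℝ} {f : ℤ → S} (h : IsQIEmbeddingWith edist q f) (m n : ℤ) :
    |(m : ℝ) - n| / q - q ≤ dist (f m) (f n) := by
  have := (h.2 m n).1
  rw [edist_dist, ENNReal.ofReal_le_ofReal_iff dist_nonneg] at this
  exact this

/-- Linear growth of the chain distance along an orbit that skewers a curtain. -/
lemma exists_le_chainDist_zpow (hS : IsGeodesicSpace S) {g : S ≃ᵢ S} {k : Curtain S} {n₀ : ℤ}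
    (H : Before k (k.map (g ^ n₀))) {q : ℝ}
    (hq : IsQIEmbeddingWith edist q fun n : ℤ => (g ^ n : S ≃ᵢ S) (k.path k.a)) :
    ∃ ε C : ℝ, 0 < ε ∧ 0 ≤ C ∧ ∀ m n : ℤ, ENNReal.ofReal (ε * |(m : ℝ) - n| - C) ≤
      chainDist ⌈24 * k.D⌉₊ (principal ((g ^ m : S ≃ᵢ S) (k.path k.a)))
        (principal ((g ^ n : S ≃ᵢ S) (k.path k.a))) := by
  set s := k.path k.a
  set R := ⌈24 * k.D⌉₊
  have hn0 : n₀ ≠ 0 := by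
    rintro rfl
    have := H.plus_ssubset
    rw [zpow_zero, map_plus] at this
    simp at this
  have hN : (0 : ℝ) < |(n₀ : ℝ)| := abs_pos.2 (by exact_mod_cast hn0)
  have hq1 := hq.1
  set K : ℝ := q * |(n₀ : ℝ)| + q + 2 with hK
  have hK0 : 0 ≤ K := by positivity
  refine ⟨1 / (28 * |(n₀ : ℝ)|), 3 + K, by positivity, by positivity, fun m n => ?_⟩
  refine le_trans ?_ (ENat.toENNReal_le.2 (chainDist_zpow_le hS R g s m n))
  -- Growth is known only along powers of `g ^ n₀`. The remainder moves the orbit point a bounded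
  -- distance, which changes the chain distance by at most `K`.
  set r := (n - m) % n₀
  set i := (n - m) / n₀
  have hr0 : 0 ≤ r := Int.emod_nonneg _ hn0
  have hrN : (r : ℝ) ≤ |(n₀ : ℝ)| := by exact_mod_cast (Int.emod_lt_abs (n - m) hn0).le
  have hdiv : n₀ * i + r = n - m := Int.mul_ediv_add_emod _ _
  have h1 : chainDist R (principal ((g ^ (n - m) : S ≃ᵢ S) s))
      (principal (((g ^ n₀) ^ i : S ≃ᵢ S) s)) ≤ ENNReal.ofReal K := by
    refine (chainDist_principal_le hS R _ _).trans (ENNReal.ofReal_le_ofReal ?_)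
    rw [← zpow_mul]
    have := hq.dist_le (n - m) (n₀ * i)
    have e : (((n - m : ℤ) : ℝ) - ((n₀ * i : ℤ) : ℝ)) = r := by
      rw [← Int.cast_sub]
      congr 1
      omega
    have hr0' : (0 : ℝ) ≤ r := by exact_mod_cast hr0
    rw [e, abs_of_nonneg hr0'] at this
    have h2 : q * r ≤ q * |(n₀ : ℝ)| := by gcongr
    simp only [hK]
    linarith
  have hM : ∃ M : ℕ, (28 * M < i.natAbs ∨ M = 0) ∧ i.natAbs ≤ 28 * (M + 1) :=
    ⟨(i.natAbs - 1) / 28, by omega, by omega⟩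
  obtain ⟨M, hM1, hM2⟩ := hM
  have h2 : (M : ℕ∞) ≤ chainDist R (principal s) (principal (((g ^ n₀) ^ i : S ≃ᵢ S) s)) := by
    rcases hM1 with h | rfl
    · exact (natCast_le_chainDist_pow hS H h).trans (chainDist_zpow_natAbs hS R _ s i)
    · simp
  have h3 : ENNReal.ofReal M ≤ chainDist R (principal s) (principal ((g ^ (n - m) : S ≃ᵢ S) s)) +
      ENNReal.ofReal K := by
    refine le_trans ?_ (add_le_add le_rfl h1)
    rw [← ENat.toENNReal_add]
    refine le_trans ?_ (ENat.toENNReal_le.2 (h2.trans (chainDist_triangle hS R _ _ _)))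
    simp
  refine le_trans (ENNReal.ofReal_le_ofReal ?_) (ofReal_sub_le_of_le_add hK0 h3)
  have e1 : |(m : ℝ) - n| ≤ |(n₀ : ℝ)| * (|(i : ℝ)| + 1) := by
    have : (m : ℝ) - n = -(n₀ * i + r) := by
      have := congrArg (Int.cast : ℤ → ℝ) hdiv
      push_cast at this
      linarith
    rw [this, abs_neg]
    refine (abs_add_le _ _).trans ?_
    rw [abs_mul, abs_of_nonneg (by exact_mod_cast hr0 : (0 : ℝ) ≤ r)]
    linarith
  have e2 : |(i : ℝ)| ≤ 28 * (M + 1) := by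
    have : ((i.natAbs : ℕ) : ℝ) = |(i : ℝ)| := by
      rw [Nat.cast_natAbs, Int.cast_abs]
    rw [← this]
    exact_mod_cast hM2
  have e3 : 1 / (28 * |(n₀ : ℝ)|) * |(m : ℝ) - n| ≤ M + 2 := by
    rw [one_div, inv_mul_le_iff₀ (by positivity)]
    calc _ ≤ |(n₀ : ℝ)| * (|(i : ℝ)| + 1) := e1
      _ ≤ |(n₀ : ℝ)| * (28 * (M + 1) + 28) := by gcongr; norm_num
      _ = _ := by ring
  linarith

/-- One term of the series suffices for the lower bound, since its weight is positive. The constant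
`Q` below is the sum of all the constants the two bounds require. -/
lemma actsLoxodromically_of_before (hS : IsGeodesicSpace S) {lam : ℕ+ → ℝ}
    (hpos : ∀ R, 0 < lam R) (hsum : Summable lam) {g : S ≃ᵢ S} (hg : HasQIEmbeddedOrbits g)
    {k : Curtain S} {n₀ : ℤ} (H : Before k (k.map (g ^ n₀))) : ActsLoxodromically lam g := by
  set s := k.path k.a with hs
  obtain ⟨q, hq⟩ := hg s
  obtain ⟨ε, C, hε, hC, hlow⟩ := exists_le_chainDist_zpow hS H hq
  have hq1 := hq.1
  have hR : 0 < ⌈24 * k.D⌉₊ := Nat.ceil_pos.2 (by linarith [k.D_pos])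
  set R : ℕ+ := ⟨⌈24 * k.D⌉₊, hR⟩ with hRdef
  set Λ := ∑' R, lam R with hΛ
  have hΛ0 : 0 ≤ Λ := tsum_nonneg fun R => (hpos R).le
  have hl := hpos R
  refine ⟨principal s, fun t => (gradedDist_principal_le hS hpos hsum t s).trans_lt
    ENNReal.ofReal_lt_top, 1 + 1 / (lam R * ε) + lam R * C + Λ * q + Λ * (q + 2), ?_, ?_⟩
  · have : 0 ≤ 1 / (lam R * ε) + lam R * C + Λ * q + Λ * (q + 2) := by positivity
    linarith
  intro m n
  set Q := 1 + 1 / (lam R * ε) + lam R * C + Λ * q + Λ * (q + 2) with hQ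
  have p1 : 0 ≤ 1 / (lam R * ε) := by positivity
  have p2 : 0 ≤ lam R * C := by positivity
  have p3 : 0 ≤ Λ * q := by positivity
  have p4 : 0 ≤ Λ * (q + 2) := by positivity
  have habs : 0 ≤ |(m : ℝ) - n| := abs_nonneg _
  simp only [principal_map]
  constructor
  · calc ENNReal.ofReal (|(m : ℝ) - n| / Q - Q)
        ≤ ENNReal.ofReal (lam R * (ε * |(m : ℝ) - n| - C)) := by
          refine ENNReal.ofReal_le_ofReal ?_
          have : |(m : ℝ) - n| / Q ≤ lam R * ε * |(m : ℝ) - n| := by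
            rw [div_le_iff₀ (by linarith)]
            have h1 : 1 ≤ lam R * ε * Q := by
              calc (1 : ℝ) = lam R * ε * (1 / (lam R * ε)) := by field_simp
                _ ≤ _ := by gcongr; linarith
            nlinarith
          linarith
      _ = ENNReal.ofReal (lam R) * ENNReal.ofReal (ε * |(m : ℝ) - n| - C) :=
          ENNReal.ofReal_mul hl.le
      _ ≤ ENNReal.ofReal (lam R) * _ := by gcongr; exact hlow m n
      _ ≤ _ := ENNReal.le_tsum (f := fun R : ℕ+ => ENNReal.ofReal (lam R) *
          (chainDist R (principal ((g ^ m : S ≃ᵢ S) s)) (principal ((g ^ n : S ≃ᵢ S) s)) : ℝ≥0∞)) R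
  · refine (gradedDist_principal_le hS hpos hsum _ _).trans (ENNReal.ofReal_le_ofReal ?_)
    have h1 := hq.dist_le m n
    calc Λ * (dist ((g ^ m : S ≃ᵢ S) s) ((g ^ n : S ≃ᵢ S) s) + 2)
        ≤ Λ * (q * |(m : ℝ) - n| + q + 2) := by gcongr
      _ = Λ * q * |(m : ℝ) - n| + Λ * (q + 2) := by ring
      _ ≤ Q * |(m : ℝ) - n| + Q := by gcongr <;> linarith

end Skewering

/-! ### From loxodromic action to a strongly contracting orbit. -/

section Loxodromic

variable {S : Type*} [MetricSpace S]

open Curtain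

lemma dist_le_mul_sub {t : ℕ → S} {N : ℕ} {K : ℝ} (h : ∀ j < N, dist (t j) (t (j + 1)) ≤ K)
    {a b : ℕ} (hab : a ≤ b) (hb : b ≤ N) : dist (t a) (t b) ≤ K * (b - a) := by
  induction b, hab using Nat.le_induction with
  | base => simp
  | succ b _ ih =>
    push_cast
    linarith [ih (by omega), h b (by omega), dist_triangle (t a) (t b) (t (b + 1))]

/-- A long chain of curtains separating the ends of a discrete path forces the path to pass close
to the poles of some curtain in each long block of the chain. -/
lemma exists_curtain_close (hS : IsGeodesicSpace S) {t : ℕ → S} {N w m : ℕ} {K B : ℝ}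
    (hK : 0 ≤ K) (hstep : ∀ j < N, dist (t j) (t (j + 1)) ≤ K) {h : ℕ → Curtain S}
    (hb : ∀ i j, i < j → j < m → Before (h i) (h j)) (h0 : ∀ i < m, t 0 ∈ (h i).minus)
    (hN : ∀ i < m, t N ∈ (h i).plus) (hw : 0 < w) (hB : N ≤ w * B) {a : ℕ} (ha : a + w < m) :
    ∃ i, a < i ∧ i ≤ a + w ∧ 24 * (h i).D ≤ 13 * (K * B) ∧
      ∃ j ≤ N, dist (t j) ((h i).path (h i).a) ≤ 13 * (K * B) + K := by
  classical
  -- The last time at which the path has not yet passed the `i`-th curtain; nesting makes it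
  -- monotone in `i`.
  set J : ℕ → ℕ := fun i => Nat.findGreatest (fun j => t j ∉ (h i).plus) N
  have J1 : ∀ i < m, t (J i) ∉ (h i).plus := fun i hi =>
    Nat.findGreatest_spec (P := fun j => t j ∉ (h i).plus) (Nat.zero_le N)
      (notMem_plus_of_mem_minus (h0 i hi))
  have J2 : ∀ i < m, J i < N := fun i hi =>
    lt_of_le_of_ne (Nat.findGreatest_le N) fun e => J1 i hi (e ▸ hN i hi)
  have J3 : ∀ i < m, t (J i + 1) ∈ (h i).plus := fun i hi =>
    not_not.1 (Nat.findGreatest_is_greatest (P := fun j => t j ∉ (h i).plus)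
      (Nat.lt_succ_self _) (J2 i hi))
  have J4 : ∀ i, i + 1 < m → J i ≤ J (i + 1) := fun i hi =>
    Nat.le_findGreatest (J2 i (by omega)).le
      (notMem_plus_of_mem_minus ((hb i (i + 1) (by omega) hi).minus (J1 i (by omega))))
  have hd : dist (t 0) (t N) ≤ K * N := by
    simpa using dist_le_mul_sub hstep (Nat.zero_le N) le_rfl
  have hs1 := sum_le_dist hS w (fun r => h (a + r + 1)) (t 0) (t N)
    (fun i j hij hj => hb _ _ (by omega) (by omega)) (fun i hi => h0 _ (by omega))
    (fun i hi => hN _ (by omega))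
  have hs2 : ∑ r ∈ Finset.range w, ((J (a + r + 1) : ℝ) - J (a + r)) ≤ N := by
    have := Finset.sum_range_sub (fun r => (J (a + r) : ℝ)) w
    simp only [← add_assoc] at this
    rw [this]
    have e1 : (J (a + w) : ℝ) ≤ N := by exact_mod_cast (J2 _ ha).le
    have e2 : (0 : ℝ) ≤ J (a + 0) := by positivity
    linarith
  -- Both the path length spent on a block and the total thickness `∑ 2 * D` are at most `K * N`. By
  -- averaging, some curtain has cost at most `(1 + 12) * K * N / w`; the weight 12 turns `2 * D`
  -- into the bottleneck radius `24 * D`.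
  obtain ⟨r, hr, hcost⟩ : ∃ r ∈ Finset.range w,
      K * ((J (a + r + 1) : ℝ) - J (a + r)) + 12 * (2 * (h (a + r + 1)).D) ≤ 13 * (K * B) := by
    refine Finset.exists_le_of_sum_le (Finset.nonempty_range_iff.2 hw.ne') ?_
    rw [Finset.sum_add_distrib, ← Finset.mul_sum, ← Finset.mul_sum, Finset.sum_const,
      Finset.card_range, nsmul_eq_mul]
    have e1 := mul_le_mul_of_nonneg_left hs2 hK
    have e2 := mul_le_mul_of_nonneg_left hB hK
    linarith
  rw [Finset.mem_range] at hr
  have hmono := J4 (a + r) (by omega)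
  have hmono' : (J (a + r) : ℝ) ≤ J (a + r + 1) := by exact_mod_cast hmono
  have hDr := (h (a + r + 1)).D_pos
  have hK' := mul_nonneg hK (sub_nonneg.2 hmono')
  refine ⟨a + r + 1, by omega, by omega, by linarith, J (a + r), (J2 _ (by omega)).le, ?_⟩
  obtain ⟨z, hz, hzc⟩ := (h (a + r + 1)).isGate hS le_rfl (t (J (a + r)))
    ((hb (a + r) (a + r + 1) (by omega) (by omega)).minus (J1 _ (by omega)))
    (t (J (a + r + 1) + 1)) (J3 _ (by omega))
  have hl := dist_le_mul_sub hstep (show J (a + r) ≤ J (a + r + 1) + 1 by omega)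
    (J2 (a + r + 1) (by omega))
  push_cast at hl
  have := dist_nonneg (x := z) (y := t (J (a + r + 1) + 1))
  linarith [dist_triangle (t (J (a + r))) z ((h (a + r + 1)).path (h (a + r + 1)).a)]

/-- Cut the chain into nine blocks of `w` curtains. Blocks 1, 3, 5, 7, counted from 0, each supply
one thin curtain with pole near the path, serving as a gate. The other five are buffers, of
thickness at least `2 * w > 6 * R`, keeping the gates far from the endpoints and the inner two from
each other. -/
lemma hasGates_of_chain (hS : IsGeodesicSpace S) {Z : Set S} {t : ℕ → S} {N w : ℕ} {K B R : ℝ}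
    (hK : 0 ≤ K) (ht : ∀ j ≤ N, t j ∈ Z) (hstep : ∀ j < N, dist (t j) (t (j + 1)) ≤ K)
    {h : ℕ → Curtain S} (hb : ∀ i j, i < j → j < 9 * w + 1 → Before (h i) (h j))
    (h0 : ∀ i < 9 * w + 1, t 0 ∈ (h i).minus) (hN : ∀ i < 9 * w + 1, t N ∈ (h i).plus)
    (hB0 : 0 ≤ B) (hB : N ≤ w * B) (hR : 13 * (K * B) + K ≤ R) (hw : 6 * R < 2 * w) :
    HasGates Z R (t 0) (t N) := by
  have hR0 : 0 ≤ R := le_trans (by positivity) hR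
  have hw0 : 0 < w := by
    rw [Nat.pos_iff_ne_zero]
    rintro rfl
    simp at hw
    linarith
  have block : ∀ b < 4, ∃ i, (2 * b + 1) * w < i ∧ i ≤ (2 * b + 1) * w + w ∧
      24 * (h i).D ≤ 13 * (K * B) ∧
        ∃ j ≤ N, dist (t j) ((h i).path (h i).a) ≤ 13 * (K * B) + K := fun b hb4 =>
    exists_curtain_close hS hK hstep hb h0 hN hw0 hB (by
      have : (2 * b + 1) * w ≤ 7 * w := Nat.mul_le_mul_right w (by omega)
      omega)
  choose! f hf1 hf2 hf3 hf4 using block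
  have hlt : ∀ i j, i < j → j < 4 → f i < f j := fun i j hij hj => by
    have e1 := hf2 i (by omega)
    have e2 := hf1 j hj
    have e3 : (2 * i + 1 + 1) * w ≤ (2 * j + 1) * w := Nat.mul_le_mul_right w (by omega)
    rw [add_mul _ 1 w, one_mul] at e3
    omega
  have hm : ∀ i < 4, f i < 8 * w + 1 := fun i hi => by
    have e1 := hf2 i hi
    have : (2 * i + 1) * w ≤ 7 * w := Nat.mul_le_mul_right w (by omega)
    omega
  have hsum : ∀ (a : ℕ) (x y : S), a + w ≤ 9 * w + 1 → (∀ i < w, x ∈ (h (i + a)).minus) →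
      (∀ i < w, y ∈ (h (i + a)).plus) → 6 * R < dist x y := by
    intro a x y ha hx hy
    have h1 := sum_le_dist hS w (fun i => h (i + a)) x y
      (fun i j hij hj => hb _ _ (by omega) (by omega)) hx hy
    have h2 : (2 * w : ℝ) ≤ ∑ i ∈ Finset.range w, 2 * (h (i + a)).D := by
      calc (2 * w : ℝ) = ∑ i ∈ Finset.range w, (2 : ℝ) := by simp [mul_comm]
        _ ≤ _ := Finset.sum_le_sum fun i _ => by linarith [(h (i + a)).one_le_D]
    linarith
  have hcp : ∀ i j, i < f j → j < 4 → (h (f j)).path (h (f j)).a ∈ (h i).plus :=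
    fun i j hij hj => (hb i (f j) hij (by have := hm j hj; omega)).plus
      (notMem_minus_of_mem_carrier (h (f j)).path_a_mem_carrier)
  have hcm : ∀ i j, f j < i → i < 9 * w + 1 → (h (f j)).path (h (f j)).a ∈ (h i).minus :=
    fun i j hij hi => (hb (f j) i hij hi).minus
      (notMem_plus_of_mem_carrier (h (f j)).path_a_mem_carrier)
  refine ⟨fun i => (h (f i)).minus, fun i => (h (f i)).plus, fun i => (h (f i)).path (h (f i)).a,
    fun i hi => (h (f i)).isGate hS (by linarith [hf3 i hi]), fun i hi => ?_,
    fun i j hij hj => hb _ _ (hlt i j hij hj) (by have := hm j hj; omega),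
    h0 _ (by have := hm 0 (by norm_num); omega), hN _ (by have := hm 3 (by norm_num); omega),
    ?_, ?_, ?_⟩
  · obtain ⟨j, hj, hd⟩ := hf4 i hi
    exact ⟨t j, ht j hj, hd.trans hR⟩
  · have := hsum 0 (t 0) ((h (f 0)).path (h (f 0)).a) (by omega) (fun i hi => h0 _ (by omega))
      (fun i hi => hcp _ 0 (by have := hf1 0 (by norm_num); omega) (by norm_num))
    linarith
  · have h3 := hm 3 (by norm_num)
    have := hsum (8 * w + 1) ((h (f 3)).path (h (f 3)).a) (t N) (by omega)
      (fun i hi => hcm _ 3 (by omega) (by omega)) (fun i hi => hN _ (by omega))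
    rw [dist_comm]
    linarith
  · have h1 := hf2 1 (by norm_num)
    have h2 := hf1 2 (by norm_num)
    exact hsum (4 * w + 1) _ _ (by omega) (fun i hi => hcm _ 1 (by omega) (by omega))
      (fun i hi => hcp _ 2 (by omega) (by norm_num))

lemma closestPoints_orbit_nonempty {s : ℤ → S} {q : ℝ} (hq : 1 ≤ q)
    (hlow : ∀ m n : ℤ, |(m : ℝ) - n| / q - q ≤ dist (s m) (s n)) (x : S) :
    (closestPoints (range s) x).Nonempty := by
  have hfin : {i : ℤ | dist x (s i) ≤ dist x (s 0)}.Finite := by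
    refine (Set.finite_Icc (-⌈q * (2 * dist x (s 0) + q)⌉) ⌈q * (2 * dist x (s 0) + q)⌉).subset ?_
    intro i hi
    have h1 := hlow i 0
    have h2 := dist_triangle_left (s i) (s 0) x
    have h3 : dist x (s i) ≤ dist x (s 0) := hi
    have h4 : |(i : ℝ)| ≤ q * (2 * dist x (s 0) + q) := by
      rw [Int.cast_zero, sub_zero] at h1
      rw [← div_le_iff₀' (by linarith)]
      linarith
    have h5 := abs_le.1 (h4.trans (Int.le_ceil _))
    exact ⟨by exact_mod_cast h5.1, by exact_mod_cast h5.2⟩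
  obtain ⟨i, hi, hmin⟩ := hfin.exists_minimalFor (fun i => dist x (s i)) _ ⟨0, le_refl (dist x (s 0))⟩
  refine ⟨s i, ⟨i, rfl⟩, ?_⟩
  rintro _ ⟨j, rfl⟩
  rcases le_total (dist x (s j)) (dist x (s 0)) with h | h
  · by_contra! hlt
    exact absurd (hmin h hlt.le) (not_le.2 hlt)
  · exact le_trans hi h

/-- Loxodromic isometries of the graded dual have linearly growing chain distances. -/
lemma exists_le_chainDist_of_gradedDist (hS : IsGeodesicSpace S) {lam : ℕ+ → ℝ}
    (hpos : ∀ R, 0 < lam R) (hsum : Summable lam) {g : S ≃ᵢ S}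
    {x : WallUltrafilter (curtainWalls S)} (hx : x ∈ gradedDual S lam) {q : ℝ}
    (hq : IsQIEmbeddingWith (gradedDist lam) q fun n : ℤ => x.map (g ^ n : S ≃ᵢ S)) (s : S) :
    ∃ ε C : ℝ, 0 < ε ∧ ∀ u v : ℤ, C ≤ |(u : ℝ) - v| → ∃ R : ℕ, ∀ M : ℕ,
      (M : ℝ) ≤ ε * |(u : ℝ) - v| → (M : ℕ∞) ≤
        chainDist R (principal ((g ^ u : S ≃ᵢ S) s)) (principal ((g ^ v : S ≃ᵢ S) s)) := by
  have hq1 := hq.1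
  set Λ := ∑' R, lam R with hΛ
  have hΛ0 : 0 < Λ := (hpos 1).trans_le (hsum.le_tsum 1 fun R _ => (hpos R).le)
  set C := (gradedDist lam (principal s) x).toReal with hC
  have hC0 : 0 ≤ C := ENNReal.toReal_nonneg
  have hCx : gradedDist lam (principal s) x = ENNReal.ofReal C :=
    (ENNReal.ofReal_toReal (hx s).ne).symm
  refine ⟨1 / (2 * q * Λ), 2 * q * (q + 2 * C + 1), by positivity, fun u v huv => ?_⟩
  by_contra! hcon
  set T := |(u : ℝ) - v| with hT
  have hT0 : 0 ≤ T := abs_nonneg _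
  have key : gradedDist lam (principal ((g ^ u : S ≃ᵢ S) s)) (principal ((g ^ v : S ≃ᵢ S) s)) ≤
      ENNReal.ofReal (Λ * (1 / (2 * q * Λ) * T)) := by
    refine gradedDist_le_of_chainDist_le hpos hsum fun R => ?_
    obtain ⟨M, hM, hlt⟩ := hcon R
    calc _ ≤ (((M : ℕ) : ℕ∞) : ℝ≥0∞) := ENat.toENNReal_le.2 hlt.le
      _ = ENNReal.ofReal M := by simp
      _ ≤ _ := ENNReal.ofReal_le_ofReal hM
  have h1 : ∀ n : ℤ, gradedDist lam (principal ((g ^ n : S ≃ᵢ S) s)) (x.map (g ^ n : S ≃ᵢ S)) ≤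
      ENNReal.ofReal C := fun n => by
    rw [← principal_map, ← hCx]
    exact gradedDist_map_le hS lam _ _ _
  have h1' := h1 u
  rw [gradedDist_comm] at h1'
  have h2 := (hq.2 u v).1.trans ((gradedDist_triangle hS lam _
    (principal ((g ^ u : S ≃ᵢ S) s)) _).trans (add_le_add h1' ((gradedDist_triangle hS lam _
      (principal ((g ^ v : S ≃ᵢ S) s)) _).trans (add_le_add key (h1 v)))))
  rw [← ENNReal.ofReal_add (by positivity) hC0, ← ENNReal.ofReal_add hC0 (by positivity),
    ENNReal.ofReal_le_ofReal_iff (by positivity)] at h2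
  have e : Λ * (1 / (2 * q * Λ) * T) = T / q / 2 := by field_simp
  rw [e] at h2
  have h3 : 2 * (q + 2 * C + 1) ≤ T / q := by
    rw [le_div_iff₀ (by linarith)]
    linarith
  linarith

lemma isStronglyContractingIsometry_of_actsLoxodromically (hS : IsGeodesicSpace S)
    {lam : ℕ+ → ℝ} (hpos : ∀ R, 0 < lam R) (hsum : Summable lam) {g : S ≃ᵢ S}
    (hg : HasQIEmbeddedOrbits g) (H : ActsLoxodromically lam g) :
    IsStronglyContractingIsometry g := by
  obtain ⟨x, hx, q', hq'⟩ := H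
  -- On an empty space there are no curtains, so all chain distances vanish and nothing is
  -- loxodromic.
  have hne : Nonempty S := by
    by_contra hemp
    rw [not_nonempty_iff] at hemp
    have hz : ∀ y z : WallUltrafilter (curtainWalls S), gradedDist lam y z = 0 := by
      intro y z
      have : ∀ R, chainDist R y z = 0 := fun R => by
        by_contra h0
        obtain ⟨h, -⟩ := (le_chainDist_iff (M := 1) hS).1 (Order.one_le_iff_ne_zero.2 h0)
        exact hemp.elim ((h 0).path 0)
      simp [gradedDist, this]
    have := (hq'.2 ⌈q' * (q' + 1)⌉ 0).1
    have hq1 := hq'.1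
    rw [hz, nonpos_iff_eq_zero, ENNReal.ofReal_eq_zero, Int.cast_zero, sub_zero] at this
    have h1 : q' * (q' + 1) ≤ |((⌈q' * (q' + 1)⌉ : ℤ) : ℝ)| := (Int.le_ceil _).trans (le_abs_self _)
    rw [← le_div_iff₀' (by linarith)] at h1
    linarith
  obtain ⟨s⟩ := hne
  obtain ⟨q, hq⟩ := hg s
  have hq1 := hq.1
  obtain ⟨ε, C, hε, hlow⟩ := exists_le_chainDist_of_gradedDist hS hpos hsum hx hq' s
  set K := 2 * q with hK
  -- The gate radius `R` depends only on `q` and `ε`, not on the separation constant `R'` of the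
  -- chain below. With `w` about `ε * N / 18`, the `9 * w + 3` walls needed are available, and `N ≤
  -- w * B` and `6 * R < 2 * w` hold once `N` is large.
  set B := 36 / ε with hBdef
  have hB0 : 0 ≤ B := by positivity
  set R := 13 * (K * B) + K with hR
  have hR0 : 0 ≤ R := by positivity
  set T₀ := max C ((36 + 108 * R) / ε + 36 / ε) with hT₀
  have hT0 : 0 ≤ T₀ := le_trans (by positivity) (le_max_right _ _)
  have hstep : ∀ i : ℤ, dist ((g ^ i : S ≃ᵢ S) s) ((g ^ (i + 1) : S ≃ᵢ S) s) ≤ K := fun i => by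
    have := hq.dist_le i (i + 1)
    push_cast at this
    rw [show (i : ℝ) - (i + 1) = -1 by ring, abs_neg, abs_one] at this
    linarith
  have key : ∀ u v : ℤ, u ≤ v → T₀ ≤ |(u : ℝ) - v| →
      HasGates (range fun n : ℤ => (g ^ n : S ≃ᵢ S) s) R
        ((g ^ u : S ≃ᵢ S) s) ((g ^ v : S ≃ᵢ S) s) ∨
      HasGates (range fun n : ℤ => (g ^ n : S ≃ᵢ S) s) R
        ((g ^ v : S ≃ᵢ S) s) ((g ^ u : S ≃ᵢ S) s) := by
    intro u v huv hT
    obtain ⟨N, hN⟩ := Int.eq_ofNat_of_zero_le (sub_nonneg.2 huv)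
    obtain ⟨R', hR'⟩ := hlow u v ((le_max_left _ _).trans hT)
    have hTN : |(u : ℝ) - v| = N := by
      rw [abs_sub_comm, ← Int.cast_sub, hN, Int.cast_natCast, Nat.abs_cast]
    rw [hTN] at hT hR'
    have hεN : 36 + 108 * R + 36 ≤ ε * N := by
      have := (le_max_right _ _).trans hT
      rw [← add_div, div_le_iff₀ hε] at this
      linarith
    set w := ⌊ε * N / 18⌋₊ with hw
    have w1 : (w : ℝ) ≤ ε * N / 18 := Nat.floor_le (by positivity)
    have w2 : ε * N / 18 < w + 1 := Nat.lt_floor_add_one _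
    obtain ⟨h, hb, hor⟩ := exists_chain_of_le hS (m := 9 * w + 1) (hR' _ (by push_cast; linarith))
    have hB : (N : ℝ) ≤ w * B := by
      rw [hBdef, mul_div_assoc', le_div_iff₀ hε]
      linarith
    have h6 : 6 * R < 2 * w := by linarith
    rcases hor with hor | hor
    · left
      have := hasGates_of_chain hS (Z := range fun n : ℤ => (g ^ n : S ≃ᵢ S) s)
        (t := fun j => (g ^ (u + j : ℤ) : S ≃ᵢ S) s) (N := N) (w := w) (K := K) (B := B) (R := R)
        (by positivity) (fun j _ => ⟨_, rfl⟩)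
        (fun j _ => by push_cast; rw [← add_assoc]; exact hstep _) hb
        (fun i hi => by simpa using (hor i hi).1)
        (fun i hi => by
          rw [show u + (N : ℤ) = v by omega]
          exact (hor i hi).2) hB0 hB le_rfl h6
      rw [show u + (N : ℤ) = v by omega] at this
      simpa using this
    · right
      have := hasGates_of_chain hS (Z := range fun n : ℤ => (g ^ n : S ≃ᵢ S) s)
        (t := fun j => (g ^ (v - j : ℤ) : S ≃ᵢ S) s) (N := N) (w := w) (K := K) (B := B) (R := R)
        (by positivity) (fun j _ => ⟨_, rfl⟩)
        (fun j _ => by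
          have := hstep (v - (j + 1))
          rw [show v - (j + 1 : ℤ) + 1 = v - j by omega, dist_comm] at this
          push_cast
          exact this) hb
        (fun i hi => by simpa using (hor i hi).1)
        (fun i hi => by
          rw [show v - (N : ℤ) = u by omega]
          exact (hor i hi).2) hB0 hB le_rfl h6
      rw [show v - (N : ℤ) = u by omega] at this
      simpa using this
  refine ⟨2 * (q * T₀ + q) + 1, q, s, hq, isStronglyContractingSet_of_hasGates (R := R)
    (by positivity) (closestPoints_orbit_nonempty hq1 hq.le_dist) ?_⟩
  rintro _ ⟨u, rfl⟩ _ ⟨v, rfl⟩ hd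
  have hT : T₀ ≤ |(u : ℝ) - v| := by
    by_contra! hlt
    have h1 := hq.dist_le u v
    have h2 : q * |(u : ℝ) - v| ≤ q * T₀ := by gcongr
    linarith
  rcases le_total u v with huv | huv
  · exact key u v huv hT
  · exact (key v u huv (by rwa [abs_sub_comm])).symm

end Loxodromic

/-! ### From a strongly contracting orbit to a skewered curtain. -/

section ContractingOrbit

variable {S : Type*} [MetricSpace S] {D q R : ℝ} {M : ℤ} {s : ℤ → S}

open Curtain

/-- A bi-infinite quasigeodesic with strongly contracting image. -/
structure IsContractingQuasigeodesic (D q : ℝ) (s : ℤ → S) : Prop where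
  D_pos : 0 < D
  one_le : 1 ≤ q
  lower : ∀ m n : ℤ, |(m : ℝ) - n| / q - q ≤ dist (s m) (s n)
  upper : ∀ m n : ℤ, dist (s m) (s n) ≤ q * |(m : ℝ) - n| + q
  contracting : IsStronglyContractingSet D (range s)

/-- Geodesics between points projecting to `s u` and to `s v` pass close to `s i`, for all `i`
well between `u` and `v`. -/
def PassesClose (s : ℤ → S) (R : ℝ) (M : ℤ) : Prop :=
  ∀ (γ : ℝ → S) (ℓ : ℝ) (u v i : ℤ), IsGeodesic γ ℓ → s u ∈ closestPoints (range s) (γ 0) →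
    s v ∈ closestPoints (range s) (γ ℓ) → u + M ≤ i → i + M ≤ v →
      ∃ t ∈ Icc 0 ℓ, dist (γ t) (s i) ≤ R

namespace IsContractingQuasigeodesic

lemma nonempty (hs : IsContractingQuasigeodesic D q s) (x : S) :
    ∃ u, s u ∈ closestPoints (range s) x := by
  obtain ⟨p, hp⟩ := closestPoints_orbit_nonempty hs.one_le hs.lower x
  obtain ⟨u, rfl⟩ := hp.1
  exact ⟨u, hp⟩

lemma abs_sub_le (hs : IsContractingQuasigeodesic D q s) {m n : ℤ} {d : ℝ}
    (h : dist (s m) (s n) ≤ d) : |(m : ℝ) - n| ≤ q * (d + q) := by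
  have := hs.lower m n
  have := hs.one_le
  rw [← div_le_iff₀' (by linarith)]
  linarith

/-- At some time the projection jumps over the index `i`, by a bounded amount, so `γ t` projects
near `s i`. Both before and after `t` the geodesic must come within `4 * D` of the orbit, since a
far geodesic cannot project as far as `s u` or `s v`. Hence `γ t` is within `11 * D` of the orbit.
-/
lemma exists_passesClose (hs : IsContractingQuasigeodesic D q s) :
    ∃ (R : ℝ) (M : ℤ), 11 * D ≤ R ∧ 0 ≤ M ∧ PassesClose s R M := by
  have hD := hs.D_pos
  have hq := hs.one_le
  have hne := closestPoints_orbit_nonempty hs.one_le hs.lower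
  set C := q * (q * (D + 4 + q)) + q with hC
  have hC0 : 0 ≤ C := by positivity
  have hM0 : 0 ≤ q * (5 * D + C + q) := by positivity
  refine ⟨11 * D + C, ⌊q * (5 * D + C + q)⌋ + 1, by linarith, ?_, ?_⟩
  · have := Int.floor_nonneg.2 hM0
    omega
  intro γ ℓ u v i hγ hu hv hui hiv
  have hMlt := Int.lt_floor_add_one (q * (5 * D + C + q))
  set M := ⌊q * (5 * D + C + q)⌋ + 1 with hM
  have hMpos : 0 < M := by
    have := Int.floor_nonneg.2 hM0
    omega
  obtain ⟨t, t', h0, htt, ht', htt', ⟨j, hji, hj⟩, j', hij', hj'⟩ :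
      ∃ t t' : ℝ, 0 ≤ t ∧ t ≤ t' ∧ t' ≤ ℓ ∧ t' ≤ t + 1 ∧
        (∃ j ≤ i, s j ∈ closestPoints (range s) (γ t)) ∧
          ∃ j', i ≤ j' ∧ s j' ∈ closestPoints (range s) (γ t') := by
    by_cases hl : ∃ j ≤ i, s j ∈ closestPoints (range s) (γ ℓ)
    · exact ⟨ℓ, ℓ, hγ.1, le_rfl, le_rfl, by linarith, hl, v, by omega, hv⟩
    · obtain ⟨t, t', h0, htt, ht', htt', hP, hnP⟩ := exists_transition
        (P := fun t => ∃ j ≤ i, s j ∈ closestPoints (range s) (γ t)) hγ.1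
        ⟨u, by omega, hu⟩ hl
      obtain ⟨j', hj'⟩ := hs.nonempty (γ t')
      refine ⟨t, t', h0, htt, ht', htt', hP, j', ?_, hj'⟩
      by_contra! hlt
      exact hnP ⟨j', hlt.le, hj'⟩
  have hdt := hγ.dist_eq h0 htt ht'
  -- Contraction gives `D` if `γ t` is more than 1 from the orbit; otherwise both projections are
  -- close to `γ t`.
  have hjj : dist (s j) (s j') ≤ D + 4 := by
    rcases lt_or_ge 1 (Metric.infDist (γ t) (range s)) with h | h
    · have := hs.contracting.dist_lt zero_le_one h (by rw [dist_self]; norm_num)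
        (by linarith : dist (γ t) (γ t') ≤ 1) hj hj'
      linarith
    · rw [infDist_eq_of_mem_closestPoints hj] at h
      linarith [hj'.2 _ hj.1, dist_triangle_left (s j) (s j') (γ t),
        dist_triangle (γ t) (γ t') (s j'), dist_triangle_left (γ t') (s j) (γ t)]
  have hji' : dist (s j) (s i) ≤ C := by
    have h1 := hs.abs_sub_le hjj
    have h2 : |(j : ℝ) - i| ≤ |(j : ℝ) - j'| := by
      have e1 : (j : ℝ) ≤ i := by exact_mod_cast hji
      have e2 : (i : ℝ) ≤ j' := by exact_mod_cast hij'
      rw [abs_of_nonpos (by linarith), abs_of_nonpos (by linarith)]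
      linarith
    have h3 := mul_le_mul_of_nonneg_left (h2.trans h1) (by linarith : 0 ≤ q)
    linarith [hs.upper j i]
  have far : ∀ n : ℤ, M ≤ |n - i| → 5 * D + C < dist (s n) (s i) := by
    intro n hn
    by_contra! hle
    have h1 := hs.abs_sub_le hle
    have h2 : (M : ℝ) ≤ |(n : ℝ) - i| := by exact_mod_cast hn
    rw [hM] at h2
    push_cast at h2
    linarith
  obtain ⟨t₁, ht₁, n₁⟩ : ∃ t₁ ∈ Icc 0 t, Metric.infDist (γ t₁) (range s) ≤ 4 * D := by
    by_contra! hcon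
    have h1 := hs.contracting.dist_le_of_far hD hne hγ le_rfl h0 (htt.trans ht')
      (fun r hr => (hcon r hr).le) hu hj
    have h2 := far u (by rw [abs_of_nonpos (by omega)]; omega)
    linarith [dist_triangle (s u) (s j) (s i)]
  obtain ⟨t₂, ht₂, n₂⟩ : ∃ t₂ ∈ Icc t ℓ, Metric.infDist (γ t₂) (range s) ≤ 4 * D := by
    by_contra! hcon
    have h1 := hs.contracting.dist_le_of_far hD hne hγ h0 (htt.trans ht') le_rfl
      (fun r hr => (hcon r hr).le) hj hv
    have h2 := far v (by rw [abs_of_nonneg (by omega)]; omega)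
    linarith [dist_triangle_left (s v) (s i) (s j)]
  have key := hs.contracting.infDist_le_of_between hD hne hγ ht₁.1 ht₁.2 ht₂.1 ht₂.2 n₁ n₂
  rw [infDist_eq_of_mem_closestPoints hj] at key
  exact ⟨t, ⟨h0, htt.trans ht'⟩, by linarith [dist_triangle (γ t) (s j) (s i)]⟩

end IsContractingQuasigeodesic

lemma IsGeodesic.exists_between {γ : ℝ → S} {ℓ t u : ℝ} (hγ : IsGeodesic γ ℓ) (ht : t ∈ Icc 0 ℓ)
    (hu : u ∈ Icc 0 ℓ) : ∃ (δ : ℝ → S) (m : ℝ), IsGeodesic δ m ∧ δ 0 = γ t ∧ δ m = γ u ∧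
      ∀ v ∈ Icc 0 m, δ v ∈ γ '' Icc 0 ℓ := by
  rcases le_total t u with h | h
  · refine ⟨fun v => γ (t + v), u - t, hγ.subpath ht.1 h hu.2, by simp, by simp, fun v hv =>
      ⟨t + v, ⟨by linarith [ht.1, hv.1], by linarith [hu.2, hv.2]⟩, rfl⟩⟩
  · refine ⟨fun v => γ (t - v), t - u, ⟨by linarith, fun v hv w hw => ?_⟩, by simp, by simp,
      fun v hv => ⟨t - v, ⟨by linarith [hu.1, hv.2], by linarith [ht.2, hv.1]⟩, rfl⟩⟩
    rw [hγ.2 _ ⟨by linarith [hu.1, hv.2], by linarith [ht.2, hv.1]⟩ _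
      ⟨by linarith [hu.1, hw.2], by linarith [ht.2, hw.1]⟩, abs_sub_comm]
    congr 1
    ring

lemma PassesClose.isGate (hS : IsGeodesicSpace S) (h : PassesClose s R M) (i : ℤ) :
    IsGate R {x | ∃ u ≤ i - M, s u ∈ closestPoints (range s) x}
      {x | ∃ v ≥ i + M, s v ∈ closestPoints (range s) x} (s i) := by
  rintro x ⟨u, hu, hux⟩ y ⟨v, hv, hvy⟩
  obtain ⟨γ, ℓ, hγ, rfl, rfl⟩ := hS x y
  obtain ⟨t, ht, hd⟩ := h γ ℓ u v i hγ hux hvy (by omega) (by omega)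
  refine ⟨γ t, ?_, hd⟩
  rw [hγ.dist_eq le_rfl ht.1 ht.2, hγ.dist_eq ht.1 ht.2 le_rfl, hγ.dist_eq le_rfl hγ.1 le_rfl]
  ring

namespace IsContractingQuasigeodesic

variable {γ : ℝ → S} {ℓ E : ℝ} {T : ℤ}

/-- Points of a geodesic close to a contracting quasigeodesic are separated by gates as soon as
their projections are distant. -/
lemma hasGates (hs : IsContractingQuasigeodesic D q s) (hS : IsGeodesicSpace S)
    (hM : PassesClose s R M) (hMT : 2 * M ≤ T) (hT0 : 0 < T)
    (hT : q * (6 * R + E + q) < T) (hγ : IsGeodesic γ ℓ) {t t' : ℝ} (ht : t ∈ Icc 0 ℓ)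
    (ht' : t' ∈ Icc 0 ℓ) {u v : ℤ} (hu : s u ∈ closestPoints (range s) (γ t))
    (hv : s v ∈ closestPoints (range s) (γ t')) (hE : dist (γ t) (s u) ≤ E)
    (hE' : dist (γ t') (s v) ≤ E) (huv : u + 5 * T ≤ v) :
    HasGates (γ '' Icc 0 ℓ) R (γ t) (γ t') := by
  have hE0 : 0 ≤ E := dist_nonneg.trans hE
  have far : ∀ m n : ℤ, m + T ≤ n → 6 * R + E < dist (s m) (s n) := by
    intro m n hmn
    by_contra! hle
    have h1 := hs.abs_sub_le hle
    have h2 : (m : ℝ) + T ≤ n := by exact_mod_cast hmn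
    have h3 := neg_abs_le ((m : ℝ) - n)
    linarith
  obtain ⟨δ, m, hδ, h0, hm, hsub⟩ := hγ.exists_between ht ht'
  have hgate : ∀ i : ℤ, u + M ≤ i → i + M ≤ v → ∃ w ∈ γ '' Icc 0 ℓ, dist w (s i) ≤ R := by
    intro i hi hi'
    obtain ⟨r, hr, hd⟩ := hM δ m u v i hδ (h0 ▸ hu) (hm ▸ hv) hi hi'
    exact ⟨δ r, hsub r hr, hd⟩
  have hR0 : 0 ≤ R := by
    obtain ⟨w, -, hw⟩ := hgate (u + T) (by omega) (by omega)
    exact dist_nonneg.trans hw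
  have hmul : ∀ i < 4, 0 ≤ (i : ℕ) * T ∧ (i : ℕ) * T ≤ 3 * T := by
    intro i hi
    have hi' : (i : ℤ) ≤ 3 := by omega
    exact ⟨by positivity, by gcongr⟩
  -- The gates are centred at `s (u + T), ..., s (u + 4 * T)`. They are nested because `2 * M ≤ T`.
  refine ⟨fun i => {x | ∃ w ≤ (u + T + i * T) - M, s w ∈ closestPoints (range s) x},
    fun i => {x | ∃ w ≥ (u + T + i * T) + M, s w ∈ closestPoints (range s) x},
    fun i => s (u + T + i * T), fun i _ => hM.isGate hS _, fun i hi => ?_, ?_,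
    ⟨u, by push_cast; omega, hu⟩, ⟨v, by push_cast; omega, hv⟩, ?_, ?_, ?_⟩
  · have := hmul i hi
    exact hgate _ (by omega) (by omega)
  · intro i j hij _ x hx
    obtain ⟨w, hw⟩ := hs.nonempty x
    refine ⟨w, ?_, hw⟩
    by_contra! hlt
    refine hx ⟨w, ?_, hw⟩
    have : ((i : ℕ) + 1 : ℤ) * T ≤ j * T := by gcongr; omega
    rw [add_mul, one_mul] at this
    simp only [ge_iff_le]
    omega
  · have := far u (u + T + (0 : ℕ) * T) (by push_cast; omega)
    linarith [dist_triangle_left (s u) (s (u + T + (0 : ℕ) * T)) (γ t)]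
  · have := far (u + T + (3 : ℕ) * T) v (by push_cast; omega)
    linarith [dist_triangle_left (s v) (s (u + T + (3 : ℕ) * T)) (γ t'),
      dist_comm (s v) (s (u + T + (3 : ℕ) * T))]
  · have := far (u + T + (1 : ℕ) * T) (u + T + (2 : ℕ) * T) (by push_cast; omega)
    linarith

/-- A contracting quasigeodesic crosses a curtain, in the sense that points that do not lie
beyond the curtain project to a half of it, and points projecting far in the negative direction
lie before the curtain. -/
lemma exists_curtain (hs : IsContractingQuasigeodesic D q s) (hS : IsGeodesicSpace S) :
    ∃ (h : Curtain S) (J J' : ℤ),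
      (∀ x ∉ h.plus, ∀ j, s j ∈ closestPoints (range s) x → j < J) ∧
        ∀ x, ∀ j ≤ J', s j ∈ closestPoints (range s) x → x ∈ h.minus := by
  obtain ⟨R, M, hRE, hM0, hM⟩ := hs.exists_passesClose
  have hD := hs.D_pos
  have hq := hs.one_le
  have hne := closestPoints_orbit_nonempty hs.one_le hs.lower
  set E := 11 * D with hEdef
  have hE0 : 0 < E := by positivity
  have hR0 : 0 ≤ R := by linarith
  set T := max (2 * M) (⌊q * (6 * R + E + q)⌋ + 1) with hTdef
  have hMT : 2 * M ≤ T := le_max_left _ _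
  have hT : q * (6 * R + E + q) < T :=
    (Int.lt_floor_add_one _).trans_le (by exact_mod_cast le_max_right _ _)
  have hTr : (0 : ℝ) < T := lt_trans (by positivity) hT
  have hT0 : 0 < T := by exact_mod_cast hTr
  set L := 2 * E + 5 * q * T + q with hL
  have hRL : 30 * R ≤ L := by
    have h1 : 6 * R ≤ q * (6 * R + E + q) := by nlinarith
    have h2 : (T : ℝ) ≤ q * T := by nlinarith
    linarith
  have hEL : 2 * E ≤ L := by nlinarith
  have hL0 : 0 < L := by linarith
  set D' := 2 * L + 1 with hD'
  -- Large enough that the geodesic from `s 0` to `s N` contains a pole of length `20 * D'` and that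
  -- the index `e` of the end of this pole satisfies `e + 2 * M ≤ N`.
  obtain ⟨N, hN⟩ := exists_nat_ge (q * (20 * D' + E + q) + 2 * M)
  have hM0r : (0 : ℝ) ≤ M := by exact_mod_cast hM0
  obtain ⟨γ, ℓ, hγ, h0, hℓ⟩ := hS (s 0) (s N)
  have hlen : ℓ = dist (s 0) (s N) := by
    rw [← h0, ← hℓ, hγ.dist_eq le_rfl hγ.1 le_rfl, sub_zero]
  have hlen' : 20 * D' ≤ ℓ := by
    have := hs.lower 0 N
    rw [← hlen, Int.cast_zero, zero_sub, abs_neg, Int.cast_natCast, Nat.abs_cast] at this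
    have h1 : 20 * D' + E + q ≤ N / q := by
      rw [le_div_iff₀ (by linarith)]
      linarith
    linarith
  have idx0 : s 0 ∈ closestPoints (range s) (γ 0) := by
    rw [h0]
    exact mem_closestPoints_self ⟨0, rfl⟩
  have idxN : s N ∈ closestPoints (range s) (γ ℓ) := by
    rw [hℓ]
    exact mem_closestPoints_self ⟨N, rfl⟩
  have close : ∀ t ∈ Icc 0 ℓ, ∀ u, s u ∈ closestPoints (range s) (γ t) →
      dist (γ t) (s u) ≤ E := by
    intro t ht u hu
    rw [← infDist_eq_of_mem_closestPoints hu]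
    refine hs.contracting.infDist_le_of_between hD hne hγ le_rfl ht.1 ht.2 le_rfl ?_ ?_
    · rw [infDist_eq_of_mem_closestPoints idx0, h0, dist_self]; positivity
    · rw [infDist_eq_of_mem_closestPoints idxN, hℓ, dist_self]; positivity
  have far : ∀ t ∈ Icc 0 ℓ, ∀ t' ∈ Icc 0 ℓ, ∀ u v, s u ∈ closestPoints (range s) (γ t) →
      s v ∈ closestPoints (range s) (γ t') → L < dist (γ t) (γ t') →
        u + 5 * T ≤ v ∨ v + 5 * T ≤ u := by
    intro t ht t' ht' u v hu hv hd
    by_contra! hcon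
    have h1 : |(u : ℝ) - v| ≤ 5 * T := by
      rw [abs_le]
      have e1 : (v : ℝ) < u + 5 * T := by exact_mod_cast hcon.1
      have e2 : (u : ℝ) < v + 5 * T := by exact_mod_cast hcon.2
      constructor <;> linarith
    have h2 := hs.upper u v
    have h3 : q * |(u : ℝ) - v| ≤ q * (5 * T) := by gcongr
    have h4 := close t ht u hu
    have h5 := close t' ht' v hv
    linarith [dist_triangle4 (γ t) (s u) (s v) (γ t'), dist_comm (s v) (γ t')]
  have before : ∀ t ∈ Icc 0 ℓ, ∀ u v i, s u ∈ closestPoints (range s) (γ 0) →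
      s v ∈ closestPoints (range s) (γ t) → u + M ≤ i → i + M ≤ v →
        ∃ r ∈ Icc 0 t, dist (γ r) (s i) ≤ R := fun t ht u v i hu hv =>
    hM γ t u v i (hγ.initial ht) hu hv
  have after : ∀ t ∈ Icc 0 ℓ, ∀ u v i, s u ∈ closestPoints (range s) (γ t) →
      s v ∈ closestPoints (range s) (γ ℓ) → u + M ≤ i → i + M ≤ v →
        ∃ r ∈ Icc t ℓ, dist (γ r) (s i) ≤ R := by
    intro t ht u v i hu hv hui hiv
    obtain ⟨r, hr, hd⟩ := hM (fun r => γ (t + r)) (ℓ - t) u v i (hγ.subpath ht.1 ht.2 le_rfl)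
      (by simpa using hu) (by simpa using hv) hui hiv
    exact ⟨t + r, ⟨by linarith [hr.1], by linarith [hr.2]⟩, hd⟩
  have hMN : 2 * M ≤ N := by
    have : 0 ≤ q * (20 * D' + E + q) := by positivity
    have : (2 : ℝ) * M ≤ N := by linarith
    exact_mod_cast this
  -- Otherwise `γ t` projects behind `s 0`, and the rest of the geodesic, on its way to `s N`, would
  -- return to within `R` of its starting point.
  have positive : ∀ t ∈ Icc 0 ℓ, L < t → ∀ u, s u ∈ closestPoints (range s) (γ t) →
      5 * T ≤ u := by
    intro t ht htL u hu
    rcases far 0 ⟨le_rfl, hγ.1⟩ t ht 0 u idx0 hu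
      (by rwa [hγ.dist_eq le_rfl ht.1 ht.2, sub_zero]) with h | h
    · omega
    · obtain ⟨r, hr, hd⟩ := after t ht u N 0 hu idxN (by omega) (by omega)
      rw [← h0, dist_comm, hγ.dist_eq le_rfl (ht.1.trans hr.1) hr.2] at hd
      linarith [hr.1]
  have hαsub : ∀ t ∈ Icc 0 (20 * D'), t ∈ Icc 0 ℓ := fun t ht => ⟨ht.1, ht.2.trans hlen'⟩
  have hα : IsGeodesic γ (20 * D') := hγ.initial ⟨by positivity, hlen'⟩
  let h : Curtain S :=
    { D := D'
      one_le_D := by linarith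
      path := γ
      isGeodesic := hα
      contracting := by
        refine isStronglyContractingSet_of_hasGates (R := R) hL0.le
          (closestPoints_nonempty_of_isCompact (isCompact_Icc.image_of_continuousOn
            hα.continuousOn) ⟨γ 0, 0, ⟨le_rfl, hα.1⟩, rfl⟩) ?_
        rintro _ ⟨t, ht, rfl⟩ _ ⟨t', ht', rfl⟩ hd
        obtain ⟨u, hu⟩ := hs.nonempty (γ t)
        obtain ⟨v, hv⟩ := hs.nonempty (γ t')
        have e1 := close t (hαsub t ht) u hu
        have e2 := close t' (hαsub t' ht') v hv
        rcases far t (hαsub t ht) t' (hαsub t' ht') u v hu hv hd with huv | huv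
        · exact Or.inl (hs.hasGates hS hM hMT hT0 hT hα ht ht' hu hv e1 e2 huv)
        · exact Or.inr (hs.hasGates hS hM hMT hT0 hT hα ht' ht hv hu e2 e1 huv)
      a := 5 * D'
      a_pos := by positivity
      a_lt := by linarith }
  have hend : 20 * D' ∈ Icc 0 (20 * D') := ⟨by positivity, le_rfl⟩
  obtain ⟨e, he⟩ := hs.nonempty (γ (20 * D'))
  have heE := close _ (hαsub _ hend) e he
  have hepos := positive _ (hαsub _ hend) (by linarith) e he
  have heN : e + 2 * M ≤ N := by
    have h1 : dist (s e) (s 0) ≤ 20 * D' + E := by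
      have := dist_triangle_left (s e) (s 0) (γ (20 * D'))
      rw [← h0, dist_comm (γ (20 * D')) (γ 0), hα.dist_eq le_rfl hend.1 le_rfl] at this
      rw [h0] at this
      linarith
    have h2 := hs.abs_sub_le h1
    rw [Int.cast_zero, sub_zero] at h2
    have h3 : (e : ℝ) + 2 * M ≤ N := by linarith [le_abs_self (e : ℝ)]
    exact_mod_cast h3
  refine ⟨h, e + M, -M, ?_, ?_⟩
  · intro x hx j hj
    by_contra! hej
    obtain ⟨p, hp⟩ := h.closestPoints_nonempty x
    obtain ⟨t, ht, rfl⟩ := hp.1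
    have ht15 : t ≤ 5 * D' + 10 * D' := by
      by_contra! hlt
      exact hx ⟨_, hp, t, ⟨hlt, ht.2⟩, rfl⟩
    obtain ⟨u, hu⟩ := hs.nonempty (γ t)
    have hd : dist (γ t) (γ (20 * D')) = 20 * D' - t := hα.dist_eq ht.1 ht.2 le_rfl
    have hue : u + 5 * T ≤ e := by
      refine (far t (hαsub t ht) _ (hαsub _ hend) u e hu he (by linarith)).resolve_right
        fun hcon => ?_
      obtain ⟨r, hr, hrd⟩ := before t (hαsub t ht) 0 u (e + M) idx0 hu (by omega) (by omega)
      obtain ⟨r', hr', hrd'⟩ := after _ (hαsub _ hend) e N (e + M) he idxN le_rfl (by omega)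
      have h1 := dist_triangle_right (γ r) (γ r') (s (e + M))
      rw [hγ.dist_eq hr.1 (hr.2.trans (ht.2.trans hr'.1)) hr'.2] at h1
      linarith [hr.2, hr'.1]
    obtain ⟨z, hz, hzd⟩ := hM.isGate hS e (γ t) ⟨u, by omega, hu⟩ x ⟨j, hej, hj⟩
    have h1 : dist x (γ t) ≤ dist x (γ (20 * D')) := hp.2 _ ⟨_, hend, rfl⟩
    linarith [dist_triangle4 x z (s e) (γ (20 * D')), dist_comm x z, dist_comm x (γ t),
      dist_comm (s e) (γ (20 * D')), dist_triangle4 (γ t) z (s e) (γ (20 * D'))]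
  -- The same argument with the gate at `s 0 = γ 0`, which would be closer to `x` than a point `γ t`
  -- with `t ≥ 5 * D'`.
  · intro x j hj hjx
    obtain ⟨p, hp⟩ := h.closestPoints_nonempty x
    obtain ⟨t, ht, rfl⟩ := hp.1
    refine ⟨_, hp, t, ⟨ht.1, ?_⟩, rfl⟩
    change t < 5 * D'
    by_contra! hlt
    obtain ⟨u, hu⟩ := hs.nonempty (γ t)
    have hu0 := positive t (hαsub t ht) (by linarith) u hu
    obtain ⟨z, hz, hzd⟩ := hM.isGate hS 0 x ⟨j, by omega, hjx⟩ (γ t) ⟨u, by omega, hu⟩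
    have h1 : dist x (γ t) ≤ dist x (γ 0) := hp.2 _ ⟨0, ⟨le_rfl, hα.1⟩, rfl⟩
    have h2 := hα.dist_eq le_rfl ht.1 ht.2
    rw [h0] at h1 h2
    linarith [dist_triangle x z (s 0), dist_triangle_left (s 0) (γ t) z]

end IsContractingQuasigeodesic

/-- Applying `g ^ (J - J')` shifts projection indices by `J - J'`. A point not beyond `k` has
indices below `J`, so its preimage has indices below `J'` and lies before `k`. -/
lemma exists_before_of_isStronglyContractingIsometry (hS : IsGeodesicSpace S) {g : S ≃ᵢ S}
    (H : IsStronglyContractingIsometry g) :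
    ∃ (k : Curtain S) (n : ℤ), Before k (k.map (g ^ n)) := by
  obtain ⟨D, q, s, hq, hD⟩ := H
  have hs : IsContractingQuasigeodesic (max D 1) q fun n : ℤ => (g ^ n : S ≃ᵢ S) s :=
    ⟨lt_max_of_lt_right one_pos, hq.1, hq.le_dist, hq.dist_le,
      isStronglyContractingSet_mono (le_max_left _ _) hD⟩
  obtain ⟨k, J, J', h1, h2⟩ := hs.exists_curtain hS
  refine ⟨k, J - J', fun x hx => ?_⟩
  rw [map_minus]
  obtain ⟨y, rfl⟩ := (g ^ (J - J') : S ≃ᵢ S).surjective x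
  refine mem_image_of_mem _ ?_
  obtain ⟨j, hj⟩ := hs.nonempty y
  refine h2 y j ?_ hj
  have horbit : (g ^ (J - J') : S ≃ᵢ S) '' (range fun n : ℤ => (g ^ n : S ≃ᵢ S) s) =
      range fun n : ℤ => (g ^ n : S ≃ᵢ S) s := by
    ext z
    constructor
    · rintro ⟨_, ⟨n, rfl⟩, rfl⟩
      refine ⟨J - J' + n, ?_⟩
      simp only [zpow_add, IsometryEquiv.mul_apply]
    · rintro ⟨n, rfl⟩
      refine ⟨_, ⟨n - (J - J'), rfl⟩, ?_⟩
      rw [← IsometryEquiv.mul_apply, ← zpow_add, add_sub_cancel]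
  have h3 := mem_image_of_mem (g ^ (J - J') : S ≃ᵢ S) hj
  rw [← closestPoints_image, horbit, ← IsometryEquiv.mul_apply, ← zpow_add] at h3
  have := h1 _ hx (J - J' + j) h3
  omega

end ContractingOrbit

theorem mainTheorem2 {S : Type*} [MetricSpace S] (hS : IsGeodesicSpace S)
    (lam : ℕ+ → ℝ) (hpos : ∀ R, 0 < lam R) (hsum : Summable lam)
    (g : S ≃ᵢ S) (hg : HasQIEmbeddedOrbits g) :
    List.TFAE [
      IsStronglyContractingIsometry g,
      ∃ (R : ℕ) (h k : Curtain S), Curtain.BallSeparated R h k ∧ Curtain.Skewers g h k,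
      ActsLoxodromically lam g] := by
  tfae_have 1 → 2 := fun H => by
    obtain ⟨k, n, hk⟩ := exists_before_of_isStronglyContractingIsometry hS H
    exact exists_skewers_of_before hS hk
  tfae_have 2 → 3 := fun ⟨R, h, k, hb, hk⟩ => by
    obtain ⟨n, hn⟩ := Curtain.Skewers.exists_before hS hb hk
    exact actsLoxodromically_of_before hS hpos hsum hg hn
  tfae_have 3 → 1 := isStronglyContractingIsometry_of_actsLoxodromically hS hpos hsum hg
  tfae_finish
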